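/- Let $M$ be a smooth manifold (finite-dimensional, without boundary) with a smooth Riemannian metric $g$, and let $\Sigma\subset TM$ be a smooth distribution of dimension $k$, equipped with the sub-Riemannian metric $g_c=g|_\Sigma$. Let $\nabla$ be the Levi-Civita connection of $g$, let $\mathcal P:TM\to\Sigma$ be the $g$-orthogonal projection, and let $D_XY=\mathcal P(\nabla_XY)$, for horizontal vector fields $X,Y\in\Gamma(\Sigma)$, be the horizontal connection. A nonholonomic geodesic is a smooth curve $\gamma$, defined on a nondegenerate interval, with $\dot\gamma(t)\in\Sigma_{\gamma(t)}$ and $D_{\dot\gamma}\dot\gamma=0$ for all $t$. Here, if $\{X_j\}$ is a smooth local frame of $\Sigma$ and $\dot\gamma=\sum_j a_j\,X_j\circ\gamma$, then $D_{\dot\gamma}\dot\gamma=\sum_j\big(\dot a_j\,X_j+a_j\,D_{\dot\gamma}X_j\big)$. Then every point $y\in M$ has an open neighbourhood $\mathcal O$ carrying a smooth frame $\{E_1,\dots,E_k\}$ of $\Sigma|_{\mathcal O}$ with $g_c(E_i,E_i)=1$ on $\mathcal O$ for every $i$, such that, for every $i=1,\dots,k$, every integral curve of $E_i$ in $\mathcal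 O$, defined on any nondegenerate interval, is a nonholonomic geodesic. -/

import Mathlib

open Bundle VectorField
open scoped Manifold ContDiff Topology

namespace SubRiemannian

set_option linter.unusedSectionVars false
set_option linter.unusedSimpArgs false

variable {E : Type*} [NormedAddCommGroup E] [NormedSpace ℝ E] [FiniteDimensional ℝ E]
  {H : Type*} [TopologicalSpace H] {I : ModelWithCorners ℝ E H}
  {M : Type*} [TopologicalSpace M] [ChartedSpace H M] [IsManifold I ∞ M]
  [RiemannianBundle (fun x : M ↦ TangentSpace I x)]
  [IsContMDiffRiemannianBundle I ∞ E (fun x : M ↦ TangentSpace I x)]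

theorem mdifferentiableAt_inner {X Z : Π x : M, TangentSpace I x} {x : M}
    (hX : MDiffAt (T% X) x) (hZ : MDiffAt (T% Z) x) :
    MDiffAt (fun y ↦ (inner ℝ (X y) (Z y) : ℝ)) x :=
  MDifferentiableAt.inner_bundle (IB := I) (F := E) (E := fun x : M ↦ TangentSpace I x)
    (b := fun x ↦ x) hX hZ

variable (I) in
/-- The right-hand side of the Koszul formula for `⟨∇_X Y, Z⟩` at `x`:
`½ (X⟨Y,Z⟩ + Y⟨X,Z⟩ - Z⟨X,Y⟩ + ⟨[X,Y],Z⟩ - ⟨[X,Z],Y⟩ - ⟨[Y,Z],X⟩)`. -/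
noncomputable def koszul (X Y Z : Π x : M, TangentSpace I x) (x : M) : ℝ :=
  (1 / 2 : ℝ) *
    (mvfderiv I (fun y ↦ (inner ℝ (Y y) (Z y) : ℝ)) x (X x)
      + mvfderiv I (fun y ↦ (inner ℝ (X y) (Z y) : ℝ)) x (Y x)
      - mvfderiv I (fun y ↦ (inner ℝ (X y) (Y y) : ℝ)) x (Z x)
      + inner ℝ (mlieBracket I X Y x) (Z x)
      - inner ℝ (mlieBracket I X Z x) (Y x)
      - inner ℝ (mlieBracket I Y Z x) (X x))

theorem koszul_tensorial_left {Y Z : Π x : M, TangentSpace I x} {x : M}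
    (hY : MDiffAt (T% Y) x) (hZ : MDiffAt (T% Z) x) :
    TensorialAt I E (fun X ↦ koszul I X Y Z x) x where
  smul {f X} hf hX := by
    have e1 := mvfderiv_fun_mul hf (mdifferentiableAt_inner hX hZ)
    have e2 := mvfderiv_fun_mul hf (mdifferentiableAt_inner hX hY)
    simp only [koszul, Pi.smul_apply', real_inner_smul_left, real_inner_smul_right,
      mlieBracket_smul_left hf hX, inner_add_left, map_smul, e1, e2]
    simp [inner_add_left, real_inner_smul_left, real_inner_comm]
    ring
  add {X X'} hX hX' := by
    have e1 := mvfderiv_fun_add (mdifferentiableAt_inner hX hZ) (mdifferentiableAt_inner hX' hZ)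
    have e2 := mvfderiv_fun_add (mdifferentiableAt_inner hX hY) (mdifferentiableAt_inner hX' hY)
    simp only [koszul, Pi.add_apply, inner_add_left, inner_add_right,
      mlieBracket_add_left hX hX', map_add, e1, e2]
    simp
    ring

theorem koszul_tensorial_right {X Y : Π x : M, TangentSpace I x} {x : M}
    (hX : MDiffAt (T% X) x) (hY : MDiffAt (T% Y) x) :
    TensorialAt I E (fun Z ↦ koszul I X Y Z x) x where
  smul {f Z} hf hZ := by
    have e1 := mvfderiv_fun_mul hf (mdifferentiableAt_inner hX hZ)
    have e2 := mvfderiv_fun_mul hf (mdifferentiableAt_inner hY hZ)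
    simp only [koszul, Pi.smul_apply', real_inner_smul_left, real_inner_smul_right,
      mlieBracket_smul_right hf hZ, inner_add_left, map_smul, e1, e2]
    simp [inner_add_left, real_inner_smul_left, real_inner_comm]
    ring
  add {Z Z'} hZ hZ' := by
    have e1 := mvfderiv_fun_add (mdifferentiableAt_inner hX hZ) (mdifferentiableAt_inner hX hZ')
    have e2 := mvfderiv_fun_add (mdifferentiableAt_inner hY hZ) (mdifferentiableAt_inner hY hZ')
    simp only [koszul, Pi.add_apply, inner_add_left, inner_add_right,
      mlieBracket_add_right hZ hZ', map_add, e1, e2]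
    simp
    ring

instance finiteDimensional_tangentSpace (x : M) : FiniteDimensional ℝ (TangentSpace I x) :=
  inferInstanceAs (FiniteDimensional ℝ E)

/-! ### The Levi-Civita connection -/

open Classical in
variable (I) in
/-- The bilinear form `(v, w) ↦ ⟨∇_v Y, w⟩` on the tangent space at `x`, for a vector field `Y`
that is differentiable at `x` (and `0` otherwise). -/
noncomputable def koszulForm (Y : Π x : M, TangentSpace I x) (x : M) :
    TangentSpace I x →L[ℝ] TangentSpace I x →L[ℝ] ℝ :=
  if hY : MDiffAt (T% Y) x then
    TensorialAt.mkHom₂ (I := I) (F := E) (F' := E) (fun X Z ↦ koszul I X Y Z x) x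
      (fun _ hZ ↦ koszul_tensorial_left hY hZ) (fun _ hX ↦ koszul_tensorial_right hX hY)
  else 0

theorem koszulForm_apply {X Y Z : Π x : M, TangentSpace I x} {x : M}
    (hX : MDiffAt (T% X) x) (hY : MDiffAt (T% Y) x) (hZ : MDiffAt (T% Z) x) :
    koszulForm I Y x (X x) (Z x) = koszul I X Y Z x := by
  rw [koszulForm, dif_pos hY]
  exact TensorialAt.mkHom₂_apply _ _ hX hZ

variable (I) in
/-- `leviCivitaFun I Y x v` is the vector `∇_v Y` at `x`, determined by the Koszul formula. -/
noncomputable def leviCivitaFun (Y : Π x : M, TangentSpace I x) (x : M) :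
    TangentSpace I x →L[ℝ] TangentSpace I x :=
  LinearMap.toContinuousLinearMap
    { toFun := fun v ↦ (InnerProductSpace.toDual ℝ (TangentSpace I x)).symm (koszulForm I Y x v)
      map_add' := fun v w ↦ by simp
      map_smul' := fun c v ↦ by simp }

theorem inner_leviCivitaFun (Y : Π x : M, TangentSpace I x) (x : M) (v w : TangentSpace I x) :
    (inner ℝ (leviCivitaFun I Y x v) w : ℝ) = koszulForm I Y x v w := by
  exact InnerProductSpace.toDual_symm_apply

theorem inner_leviCivitaFun_eq_koszul {X Y Z : Π x : M, TangentSpace I x} {x : M}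
    (hX : MDiffAt (T% X) x) (hY : MDiffAt (T% Y) x) (hZ : MDiffAt (T% Z) x) :
    (inner ℝ (leviCivitaFun I Y x (X x)) (Z x) : ℝ) = koszul I X Y Z x := by
  rw [inner_leviCivitaFun, koszulForm_apply hX hY hZ]

/-- Two endomorphisms of a tangent space agree if they have the same matrix coefficients on
differentiable vector fields. -/
theorem ext_of_inner {x : M} {A B : TangentSpace I x →L[ℝ] TangentSpace I x}
    (h : ∀ X Z : Π x : M, TangentSpace I x, MDiffAt (T% X) x → MDiffAt (T% Z) x →
      (inner ℝ (A (X x)) (Z x) : ℝ) = inner ℝ (B (X x)) (Z x)) : A = B := by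
  ext v
  refine ext_inner_right ℝ fun w ↦ ?_
  have := h (FiberBundle.extend E v) (FiberBundle.extend E w)
    (FiberBundle.mdifferentiableAt_extend ..) (FiberBundle.mdifferentiableAt_extend ..)
  simpa using this

theorem isCovariantDerivativeOn_leviCivitaFun :
    IsCovariantDerivativeOn E (leviCivitaFun I (M := M)) Set.univ where
  add {Y Y' x} hY hY' _ := by
    refine ext_of_inner fun X Z hX hZ ↦ ?_
    have hYY' : MDiffAt (T% (Y + Y')) x := mdifferentiableAt_add_section hY hY'
    have e1 := mvfderiv_fun_add (mdifferentiableAt_inner hY hZ) (mdifferentiableAt_inner hY' hZ)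
    have e2 := mvfderiv_fun_add (mdifferentiableAt_inner hX hY) (mdifferentiableAt_inner hX hY')
    rw [inner_leviCivitaFun_eq_koszul hX hYY' hZ, add_apply, inner_add_left,
      inner_leviCivitaFun_eq_koszul hX hY hZ, inner_leviCivitaFun_eq_koszul hX hY' hZ]
    simp only [koszul, Pi.add_apply, inner_add_left, inner_add_right,
      mlieBracket_add_right hY hY', mlieBracket_add_left hY hY', map_add, e1, e2]
    simp
    ring
  leibniz {Y f x} hY hf _ := by
    refine ext_of_inner fun X Z hX hZ ↦ ?_
    have hfY : MDiffAt (T% (f • Y)) x := hf.smul_section hY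
    have e1 := mvfderiv_fun_mul hf (mdifferentiableAt_inner hY hZ)
    have e2 := mvfderiv_fun_mul hf (mdifferentiableAt_inner hX hY)
    rw [inner_leviCivitaFun_eq_koszul hX hfY hZ, add_apply, inner_add_left,
      smul_apply, real_inner_smul_left,
      inner_leviCivitaFun_eq_koszul hX hY hZ, ContinuousLinearMap.smulRight_apply,
      real_inner_smul_left]
    simp only [koszul, Pi.smul_apply', real_inner_smul_left, real_inner_smul_right,
      mlieBracket_smul_right hf hY, mlieBracket_smul_left hf hY, inner_add_left, map_smul, e1, e2]
    simp [inner_add_left, real_inner_smul_left, real_inner_comm]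
    ring

variable (I M) in
/-- The Levi-Civita connection of the Riemannian metric of `M`;
`leviCivita I M Y x v` is `∇_v Y` at `x`. -/
noncomputable def leviCivita : CovariantDerivative I E (TangentSpace I : M → Type _) where
  toFun := leviCivitaFun I
  isCovariantDerivativeOnUniv := isCovariantDerivativeOn_leviCivitaFun

/-- The Levi-Civita connection is torsion-free. -/
theorem leviCivita_torsionFree {X Y : Π x : M, TangentSpace I x} {x : M}
    (hX : MDiffAt (T% X) x) (hY : MDiffAt (T% Y) x) :
    leviCivita I M Y x (X x) - leviCivita I M X x (Y x) = mlieBracket I X Y x := by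
  refine ext_inner_right ℝ fun w ↦ ?_
  have hZ : MDiffAt (T% (FiberBundle.extend E w)) x := FiberBundle.mdifferentiableAt_extend ..
  have hw : (FiberBundle.extend E w : Π x : M, TangentSpace I x) x = w := by simp
  have h1 := inner_leviCivitaFun_eq_koszul hX hY hZ
  have h2 := inner_leviCivitaFun_eq_koszul hY hX hZ
  rw [hw] at h1 h2
  rw [inner_sub_left]
  change (inner ℝ (leviCivitaFun I Y x (X x)) w : ℝ) - inner ℝ (leviCivitaFun I X x (Y x)) w = _
  rw [h1, h2]
  simp only [koszul, hw, mlieBracket_swap_apply (V := Y) (W := X), inner_neg_left]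
  simp only [real_inner_comm]
  ring

/-- The Levi-Civita connection is compatible with the metric. -/
theorem leviCivita_metric {X Y Z : Π x : M, TangentSpace I x} {x : M}
    (hX : MDiffAt (T% X) x) (hY : MDiffAt (T% Y) x) (hZ : MDiffAt (T% Z) x) :
    mvfderiv I (fun y ↦ (inner ℝ (Y y) (Z y) : ℝ)) x (X x)
      = inner ℝ (leviCivita I M Y x (X x)) (Z x) + inner ℝ (Y x) (leviCivita I M Z x (X x)) := by
  change _ = (inner ℝ (leviCivitaFun I Y x (X x)) (Z x) : ℝ)
    + inner ℝ (Y x) (leviCivitaFun I Z x (X x))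
  rw [real_inner_comm (leviCivitaFun I Z x (X x)) (Y x), inner_leviCivitaFun_eq_koszul hX hY hZ,
    inner_leviCivitaFun_eq_koszul hX hZ hY]
  simp only [koszul, mlieBracket_swap_apply (V := Z) (W := Y), inner_neg_left]
  simp only [fun y ↦ real_inner_comm (Z y) (Y y)]
  ring

/-! ### Distributions, horizontal connection, nonholonomic geodesics -/

/-- `X₁, …, X_k` is a smooth frame on `U` of the family of subspaces `S x ⊆ T_x M`: the fields are
smooth on `U` and `X₁ x, …, X_k x` is a basis of `S x` for every `x ∈ U`. -/
structure IsFrameOn {k : ℕ} (S : Π x : M, Submodule ℝ (TangentSpace I x))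
    (X : Fin k → Π x : M, TangentSpace I x) (U : Set M) : Prop where
  contMDiffOn : ∀ i, ContMDiffOn I I.tangent ∞ (fun x ↦ (⟨x, X i x⟩ : TangentBundle I M)) U
  linearIndependent : ∀ x ∈ U, LinearIndependent ℝ (fun i ↦ X i x)
  span_eq : ∀ x ∈ U, Submodule.span ℝ (Set.range fun i ↦ X i x) = S x

variable (I M) in
/-- A smooth distribution of dimension `k` on `M`. The sub-Riemannian metric `g_c` on it is the
restriction of the Riemannian metric of `M`. -/
structure SmoothDistribution (k : ℕ) where
  fiber : Π x : M, Submodule ℝ (TangentSpace I x)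
  exists_frame : ∀ x : M, ∃ U : Set M, IsOpen U ∧ x ∈ U ∧
    ∃ X : Fin k → Π y : M, TangentSpace I y, IsFrameOn fiber X U

variable {k : ℕ}

/-- The horizontal connection: `D_v Y = 𝒫 (∇_v Y)` at `x`, where `𝒫` is the orthogonal projection
onto the distribution and `∇` is the Levi-Civita connection. -/
noncomputable def horizontalConnection (S : SmoothDistribution I M k)
    (Y : Π x : M, TangentSpace I x) (x : M) (v : TangentSpace I x) : TangentSpace I x :=
  (S.fiber x).starProjection (leviCivita I M Y x v)

variable (I) in
/-- The velocity at time `t` of a curve defined on `J ⊆ ℝ`. -/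
noncomputable def velocityWithin (γ : ℝ → M) (J : Set ℝ) (t : ℝ) : TangentSpace I (γ t) :=
  mfderivWithin 𝓘(ℝ, ℝ) I γ J t (1 : ℝ)

/-- `W` is the derivative `D Y / dt` at time `t` of the horizontal vector field `Y` along the curve
`γ`, which is defined on `J`. Writing `Y = ∑ a_j X_j ∘ γ` near `t` in a local frame of the
distribution, `D Y / dt = ∑ (a_j' X_j + a_j D_{γ'} X_j)`. By the Leibniz rule for `D`, this does
not depend on the frame. -/
def HasHorizontalDerivWithinAt (S : SmoothDistribution I M k) (γ : ℝ → M)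
    (Y : Π t : ℝ, TangentSpace I (γ t)) (J : Set ℝ) (t : ℝ) (W : TangentSpace I (γ t)) : Prop :=
  ∃ U : Set M, IsOpen U ∧ γ t ∈ U ∧
    ∃ X : Fin k → Π x : M, TangentSpace I x, IsFrameOn S.fiber X U ∧
    ∃ (a : Fin k → ℝ → ℝ) (a' : Fin k → ℝ),
      (∀ᶠ s in 𝓝[J] t, Y s = ∑ j, a j s • X j (γ s)) ∧
      (∀ j, HasDerivWithinAt (a j) (a' j) J t) ∧
      W = ∑ j, (a' j • X j (γ t)
        + a j t • horizontalConnection S (X j) (γ t) (velocityWithin I γ J t))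

/-- A nonholonomic geodesic defined on the interval `J`: a smooth horizontal curve `γ` with
`D_{γ'} γ' = 0`. -/
structure IsNonholonomicGeodesicOn (S : SmoothDistribution I M k) (γ : ℝ → M) (J : Set ℝ) :
    Prop where
  contMDiffOn : ContMDiffOn 𝓘(ℝ, ℝ) I ∞ γ J
  horizontal : ∀ t ∈ J, velocityWithin I γ J t ∈ S.fiber (γ t)
  deriv_eq_zero : ∀ t ∈ J, HasHorizontalDerivWithinAt S γ (velocityWithin I γ J) J t 0

end SubRiemannian

/-! In a local frame `X_j` write `Y = ∑ a_j X_j`. Then `D_Y Y = ∑_j (Y(a_j) + ∑_{l,i} a_l a_i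
Γ_{il}^j) X_j`, where the symbols are defined by `D_{X_i} X_l = ∑_j Γ_{il}^j X_j`. Thus `D_Y Y = 0`
is a first-order quasilinear system in which every unknown is differentiated along the same vector
`∑ a_i X_i`. Such a system is solved by characteristics: prescribe constant coefficients on a
hypersurface transverse to `Y` and follow an ODE. This gives a local geodesic field with any nonzero
horizontal value at a given point (`exists_geodesic_field`).

Because `∇` is metric and `Y` is horizontal, `Y⟨Y,Y⟩ = 2⟨D_Y Y, Y⟩ = 0`. The length is constant
along `Y`, so `Y/|Y|` is again a geodesic field (`exists_unit_geodesic_field`). Starting from the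
directions of the `k` frame vectors at `y` gives `k` unit fields that are independent at `y`, hence
nearby (`exists_unit_geodesic_frame`). Orthogonality is not asked for, so the fields can be built
one at a time. Along an integral curve of `F i`, the velocity has constant coefficients in the frame
`F`, so its horizontal derivative is `D_{F i} F i = 0`.

The analytic input is smooth dependence of a flow on its initial value (`exists_smooth_flow`). It
comes from the inverse function theorem in a space of continuous curves, where `γ ↦ v ∘ γ` is
smooth. It yields the method of characteristics (`exists_smooth_solution_quasilinear`). -/

namespace SubRiemannian

/-! ### Smoothness of composition operators on spaces of continuous functions. -/

section CompositionOperator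

universe u

variable {K : Type*} [TopologicalSpace K] [CompactSpace K]
  {P Q F : Type*} [NormedAddCommGroup P] [NormedSpace ℝ P] [NormedAddCommGroup Q] [NormedSpace ℝ Q]
  [NormedAddCommGroup F] [NormedSpace ℝ F]

variable (K) in
/-- The bilinear map between spaces of continuous functions that applies a bilinear map
pointwise. -/
noncomputable def pointwiseBilinear (B : Q →L[ℝ] P →L[ℝ] F) :
    C(K, Q) →L[ℝ] C(K, P) →L[ℝ] C(K, F) :=
  LinearMap.mkContinuous₂
    (LinearMap.mk₂ ℝ (fun (A : C(K, Q)) (δ : C(K, P)) ↦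
        (⟨fun t ↦ B (A t) (δ t), by fun_prop⟩ : C(K, F)))
      (fun A B δ ↦ by ext; simp) (fun c A δ ↦ by ext; simp)
      (fun A δ ε ↦ by ext; simp) (fun c A δ ↦ by ext; simp)) ‖B‖
    (fun A δ ↦ by
      rw [ContinuousMap.norm_le _ (by positivity)]
      intro t
      exact B.le_of_opNorm₂_le_of_le le_rfl (A.norm_coe_le_norm t) (δ.norm_coe_le_norm t))

@[simp]
theorem pointwiseBilinear_apply (B : Q →L[ℝ] P →L[ℝ] F) (A : C(K, Q)) (δ : C(K, P)) (t : K) :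
    pointwiseBilinear K B A δ t = B (A t) (δ t) := rfl

theorem contDiff_pointwiseBilinear (B : Q →L[ℝ] P →L[ℝ] F) {X : Type*} [NormedAddCommGroup X]
    [NormedSpace ℝ X] {n : WithTop ℕ∞} {g : X → C(K, Q)} (hg : ContDiff ℝ n g) :
    ContDiff ℝ n fun x ↦ pointwiseBilinear K B (g x) :=
  (pointwiseBilinear K B).contDiff.comp hg

/-- The mean value inequality bounds the remainder at each `t` by the oscillation of the derivative
on the segment from `γ t` to `γ t + δ t`. Continuity of `γ ↦ v' ∘ γ` in the sup norm makes that
bound uniform in `t`. -/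
theorem hasFDerivAt_continuousMap_comp (v : C(P, F)) (B : Q →L[ℝ] P →L[ℝ] F)
    (v' : C(P, Q)) (hv' : ∀ p, HasFDerivAt v (B (v' p)) p) (γ : C(K, P)) :
    HasFDerivAt (fun γ : C(K, P) ↦ v.comp γ) (pointwiseBilinear K B (v'.comp γ)) γ := by
  rw [hasFDerivAt_iff_isLittleO_nhds_zero, Asymptotics.isLittleO_iff]
  intro ε hε
  have hc : Continuous fun γ : C(K, P) ↦ v'.comp γ := ContinuousMap.continuous_postcomp v'
  -- The `+ 1` keeps the tolerance meaningful when `B = 0`.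
  obtain ⟨r, hr, h⟩ := Metric.continuous_iff.1 hc γ (ε / (‖B‖ + 1)) (by positivity)
  filter_upwards [Metric.ball_mem_nhds (0 : C(K, P)) hr] with δ hδ
  rw [mem_ball_zero_iff] at hδ
  rw [ContinuousMap.norm_le _ (by positivity)]
  intro t
  have key := Convex.norm_image_sub_le_of_norm_hasFDerivWithin_le' (f := v)
    (f' := fun p ↦ B (v' p)) (φ := B (v' (γ t))) (C := ε) (s := segment ℝ (γ t) (γ t + δ t))
    (x := γ t) (y := γ t + δ t) (fun x _ ↦ (hv' x).hasFDerivWithinAt) ?_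
    (convex_segment _ _) (left_mem_segment ..) (right_mem_segment ..)
  · simp only [add_sub_cancel_left] at key
    simpa using key.trans (mul_le_mul_of_nonneg_left (δ.norm_coe_le_norm t) hε.le)
  · intro x hx
    rw [segment_eq_image'] at hx
    obtain ⟨s, ⟨hs0, hs1⟩, rfl⟩ := hx
    have h1 : dist (γ + s • δ) γ < r := by
      rw [dist_eq_norm, add_sub_cancel_left, norm_smul, Real.norm_of_nonneg hs0]
      exact (mul_le_of_le_one_left (norm_nonneg _) hs1).trans_lt hδ
    have h2 := ((ContinuousMap.dist_apply_le_dist t).trans_lt (h _ h1)).le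
    rw [dist_eq_norm] at h2
    simp only [add_sub_cancel_left, ← map_sub]
    calc ‖B (v' (γ t + s • δ t) - v' (γ t))‖ ≤ ‖B‖ * (ε / (‖B‖ + 1)) := by
          exact B.le_of_opNorm_le_of_le le_rfl (by simpa using h2)
      _ ≤ ε := by
          rw [mul_div_assoc', div_le_iff₀ (by positivity)]
          nlinarith [norm_nonneg B]

/-- The derivative is pointwise application of `v' ∘ γ`, which is again a composition operator, so
induction applies with `F` replaced by `P →L[ℝ] F`. The common universe of `P` and `F` is what
allows this replacement. -/
theorem contDiff_nat_continuousMap_comp (n : ℕ) {P F : Type u} [NormedAddCommGroup P]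
    [NormedSpace ℝ P] [NormedAddCommGroup F] [NormedSpace ℝ F] (v : C(P, F)) (hv : ContDiff ℝ n v) :
    ContDiff ℝ n fun γ : C(K, P) ↦ v.comp γ := by
  induction n generalizing F with
  | zero => exact contDiff_zero.2 (ContinuousMap.continuous_postcomp v)
  | succ n ih =>
    have hv1 : ContDiff ℝ (n + 1) v := mod_cast hv
    obtain ⟨hd, -, hv2⟩ := contDiff_succ_iff_fderiv.1 hv1
    let v' : C(P, P →L[ℝ] F) := ⟨fderiv ℝ v, hv2.continuous⟩
    have h := hasFDerivAt_continuousMap_comp (K := K) v (.id ℝ (P →L[ℝ] F)) v'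
      fun p ↦ (hd p).hasFDerivAt
    rw [Nat.cast_add, Nat.cast_one, contDiff_succ_iff_fderiv]
    refine ⟨fun γ ↦ (h γ).differentiableAt, by simp, ?_⟩
    rw [show fderiv ℝ (fun γ : C(K, P) ↦ v.comp γ)
        = fun γ ↦ pointwiseBilinear K (.id ℝ (P →L[ℝ] F)) (v'.comp γ)
      from funext fun γ ↦ (h γ).fderiv]
    exact contDiff_pointwiseBilinear _ (ih v' hv2)

/-- Composition with a smooth map is a smooth map between spaces of continuous functions. -/
theorem contDiff_continuousMap_comp {P F : Type u} [NormedAddCommGroup P]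
    [NormedSpace ℝ P] [NormedAddCommGroup F] [NormedSpace ℝ F] (v : C(P, F)) (hv : ContDiff ℝ ∞ v) :
    ContDiff ℝ ∞ fun γ : C(K, P) ↦ v.comp γ :=
  contDiff_infty.2 fun n ↦ contDiff_nat_continuousMap_comp n v (hv.of_le (mod_cast le_top))

end CompositionOperator

/-! ### The inverse function theorem on a neighbourhood. -/

section InverseFunction

variable {X Y : Type*} [NormedAddCommGroup X] [NormedSpace ℝ X] [CompleteSpace X]
  [NormedAddCommGroup Y] [NormedSpace ℝ Y]

/-- The inverse function theorem for maps that are smooth near a point. -/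
theorem exists_smooth_inverse {f : X → Y} {a : X} (hf : ∀ᶠ x in 𝓝 a, ContDiffAt ℝ ∞ f x)
    {f' : X ≃L[ℝ] Y} (hf' : HasFDerivAt f (f' : X →L[ℝ] Y) a) :
    ∃ g : Y → X, g (f a) = a ∧ (∀ᶠ y in 𝓝 (f a), ContDiffAt ℝ ∞ g y) ∧
      (∀ᶠ y in 𝓝 (f a), f (g y) = y) ∧ ∀ᶠ x in 𝓝 a, g (f x) = x := by
  have ha := hf.self_of_nhds
  set e := ha.toOpenPartialHomeomorph f hf' (by simp) with he
  have hef : (e : X → Y) = f := rfl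
  have hae : a ∈ e.source := ha.mem_toOpenPartialHomeomorph_source hf' (by simp)
  have hga : e.symm (f a) = a := by rw [← hef, e.left_inv hae]
  have hfa : f a ∈ e.target := hef ▸ e.map_source hae
  have hcont : ContinuousAt e.symm (f a) := e.continuousAt_symm hfa
  refine ⟨e.symm, hga, ?_, ?_, ?_⟩
  -- Smoothness of the inverse at nearby points needs an invertible derivative there; invertible
  -- operators form an open set.
  · have hinv : ∀ᶠ x in 𝓝 a, ∃ A : X ≃L[ℝ] Y, HasFDerivAt f (A : X →L[ℝ] Y) x := by
      have hc : ContinuousAt (fderiv ℝ f) a :=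
        (ha.fderiv_right (m := 0) (by simp)).continuousAt
      have := hc.preimage_mem_nhds (t := Set.range ContinuousLinearEquiv.toContinuousLinearMap)
        (by rw [hf'.fderiv]; exact f'.nhds)
      filter_upwards [this, hf] with x ⟨A, hA⟩ hx
      exact ⟨A, hA ▸ (hx.differentiableAt (by simp)).hasFDerivAt⟩
    have h := hcont.tendsto
    rw [hga] at h
    filter_upwards [h.eventually hinv, h.eventually hf, e.open_target.mem_nhds hfa]
      with y ⟨A, hA⟩ hy hyt
    exact e.contDiffAt_symm hyt hA hy
  · filter_upwards [e.open_target.mem_nhds hfa] with y hy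
    exact e.right_inv hy
  · filter_upwards [e.open_source.mem_nhds hae] with x hx
    exact e.left_inv hx

end InverseFunction

/-! ### Globalising a smooth germ. -/

section Cutoff

variable {P F : Type*} [NormedAddCommGroup P] [NormedSpace ℝ P] [FiniteDimensional ℝ P]
  [NormedAddCommGroup F] [NormedSpace ℝ F]

/-- A map that is smooth near a point agrees near this point with a smooth map. -/
theorem exists_contDiff_eventuallyEq {v : P → F} {p : P} (hv : ∀ᶠ x in 𝓝 p, ContDiffAt ℝ ∞ v x) :
    ∃ w : P → F, ContDiff ℝ ∞ w ∧ w =ᶠ[𝓝 p] v := by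
  obtain ⟨r, hr, h⟩ := Metric.eventually_nhds_iff_ball.1 hv
  let χ : ContDiffBump p := ⟨r / 4, r / 2, by positivity, by linarith⟩
  refine ⟨fun x ↦ χ x • v x, contDiff_iff_contDiffAt.2 fun x ↦ ?_, ?_⟩
  · by_cases hx : x ∈ Metric.ball p r
    · exact χ.contDiffAt.smul (h x hx)
    · have h0 : (fun x ↦ χ x • v x) =ᶠ[𝓝 x] fun _ ↦ 0 := by
        have : x ∈ (Metric.closedBall p (r / 2))ᶜ := by
          simp only [Metric.mem_ball, Set.mem_compl_iff, Metric.mem_closedBall] at hx ⊢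
          linarith
        filter_upwards [Metric.isClosed_closedBall.isOpen_compl.mem_nhds this] with z hz
        have hz' : χ z = 0 := χ.zero_of_le_dist ((not_le.1 fun h ↦ hz (Metric.mem_closedBall.2 h)).le)
        simp [hz']
      exact contDiffAt_const.congr_of_eventuallyEq h0
  · filter_upwards [χ.eventuallyEq_one] with x hx
    simp [hx]

end Cutoff

/-! ### Smooth dependence of local flows on time and initial value. -/

section Flow

universe u

variable {P : Type u} [NormedAddCommGroup P]

/-- Extension of a function on `[-1, 1]` by its boundary values. -/
noncomputable def extendUnit (f : C(Set.Icc (-1 : ℝ) 1, P)) : C(ℝ, P) :=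
  f.IccExtend (by norm_num)

theorem extendUnit_of_mem (f : C(Set.Icc (-1 : ℝ) 1, P)) {t : ℝ} (ht : t ∈ Set.Icc (-1 : ℝ) 1) :
    extendUnit f t = f ⟨t, ht⟩ :=
  Set.IccExtend_of_mem _ _ ht

theorem norm_extendUnit_le (f : C(Set.Icc (-1 : ℝ) 1, P)) (t : ℝ) : ‖extendUnit f t‖ ≤ ‖f‖ :=
  f.norm_coe_le_norm _

variable [NormedSpace ℝ P]

theorem continuous_integral_extendUnit (f : C(Set.Icc (-1 : ℝ) 1, P)) :
    Continuous fun t : ℝ ↦ ∫ s in (0 : ℝ)..t, extendUnit f s :=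
  intervalIntegral.continuous_primitive
    (fun _ _ ↦ (extendUnit f).continuous.intervalIntegrable _ _) 0

variable (P) in
/-- The primitive vanishing at `0` of a continuous function on `[-1, 1]`. -/
noncomputable def primitive :
    C(Set.Icc (-1 : ℝ) 1, P) →L[ℝ] C(Set.Icc (-1 : ℝ) 1, P) :=
  LinearMap.mkContinuous
    { toFun := fun f ↦ ⟨fun t ↦ ∫ s in (0 : ℝ)..t, extendUnit f s,
        (continuous_integral_extendUnit f).comp continuous_subtype_val⟩
      map_add' := fun f g ↦ by
        ext t
        exact intervalIntegral.integral_add ((extendUnit f).continuous.intervalIntegrable _ _)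
          ((extendUnit g).continuous.intervalIntegrable _ _)
      map_smul' := fun c f ↦ by
        ext t
        exact intervalIntegral.integral_smul c (extendUnit f) } 1
    (fun f ↦ by
      rw [ContinuousMap.norm_le _ (by positivity)]
      intro t
      refine (intervalIntegral.norm_integral_le_of_norm_le_const (C := ‖f‖)
        fun s _ ↦ norm_extendUnit_le f s).trans ?_
      rw [mul_comm, sub_zero]
      exact mul_le_mul_of_nonneg_right (abs_le.2 t.2) (norm_nonneg _))

variable [CompleteSpace P]

/-- The integral equation `γ t = p + h ∫₀ᵗ v (γ s) ds` on `[-1, 1]` is uniquely solvable near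
`h = 0`, and the solution depends smoothly on `h` and `p`. -/
theorem exists_smooth_solution_integral_eq (v : C(P, P)) (hv : ContDiff ℝ ∞ v) (p₀ : P) :
    ∃ Γ : ℝ × P → C(Set.Icc (-1 : ℝ) 1, P),
      Γ (0, p₀) = .const _ p₀ ∧ (∀ᶠ x in 𝓝 (0, p₀), ContDiffAt ℝ ∞ Γ x) ∧
      (∀ᶠ x in 𝓝 (0, p₀), Γ x = .const _ x.2 + x.1 • primitive P (v.comp (Γ x))) ∧
      ∀ᶠ q : (ℝ × P) × C(Set.Icc (-1 : ℝ) 1, P) in 𝓝 ((0, p₀), .const _ p₀),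
        q.2 = .const _ q.1.2 + q.1.1 • primitive P (v.comp q.2) → q.2 = Γ q.1 := by
  let C := C(Set.Icc (-1 : ℝ) 1, P)
  let κ : P →L[ℝ] C := .const ℝ _
  let N : C → C := fun γ ↦ primitive P (v.comp γ)
  have hN : ContDiff ℝ ∞ N := (primitive P).contDiff.comp (contDiff_continuousMap_comp v hv)
  let G : (ℝ × P) × C → (ℝ × P) × C := fun q ↦ (q.1, q.2 - κ q.1.2 - q.1.1 • N q.2)
  have hG : ContDiff ℝ ∞ G := by
    have h1 : ContDiff ℝ ∞ fun q : (ℝ × P) × C ↦ κ q.1.2 := κ.contDiff.comp (by fun_prop)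
    have h2 : ContDiff ℝ ∞ fun q : (ℝ × P) × C ↦ N q.2 := hN.comp contDiff_snd
    exact contDiff_fst.prodMk ((contDiff_snd.sub h1).sub
      ((contDiff_fst.comp contDiff_fst).smul h2))
  let q₀ : (ℝ × P) × C := ((0, p₀), κ p₀)
  let c : C := N (κ p₀)
  let T : (ℝ × P) →L[ℝ] C :=
    κ.comp (.snd ℝ ℝ P) + (ContinuousLinearMap.fst ℝ ℝ P).smulRight c
  -- At `h = 0` the derivative of `N` drops out of the derivative of `G`. What remains is `(x, δ) ↦
  -- (x, δ - T x)`, inverted by changing the sign of `T`.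
  let f' : ((ℝ × P) × C) ≃L[ℝ] ((ℝ × P) × C) := ContinuousLinearEquiv.equivOfInverse
    ((ContinuousLinearMap.fst ℝ (ℝ × P) C).prod (.snd ℝ (ℝ × P) C - T.comp (.fst ℝ (ℝ × P) C)))
    ((ContinuousLinearMap.fst ℝ (ℝ × P) C).prod (.snd ℝ (ℝ × P) C + T.comp (.fst ℝ (ℝ × P) C)))
    (fun x ↦ by ext <;> simp) (fun x ↦ by ext <;> simp)
  have hG' : HasFDerivAt G (f' : ((ℝ × P) × C) →L[ℝ] ((ℝ × P) × C)) q₀ := by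
    have hN' : HasFDerivAt (fun q : (ℝ × P) × C ↦ N q.2)
        ((fderiv ℝ N (κ p₀)).comp (.snd ℝ (ℝ × P) C)) q₀ :=
      HasFDerivAt.comp (g := N) q₀ ((hN.differentiable (by simp)) (κ p₀)).hasFDerivAt
        hasFDerivAt_snd
    have h11 : HasFDerivAt (fun q : (ℝ × P) × C ↦ q.1.1)
        ((ContinuousLinearMap.fst ℝ ℝ P).comp (.fst ℝ (ℝ × P) C)) q₀ :=
      ((ContinuousLinearMap.fst ℝ ℝ P).comp (.fst ℝ (ℝ × P) C)).hasFDerivAt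
    have hκ : HasFDerivAt (fun q : (ℝ × P) × C ↦ κ q.1.2)
        ((κ.comp (.snd ℝ ℝ P)).comp (.fst ℝ (ℝ × P) C)) q₀ :=
      ((κ.comp (.snd ℝ ℝ P)).comp (.fst ℝ (ℝ × P) C)).hasFDerivAt
    refine (hasFDerivAt_fst.prodMk ((hasFDerivAt_snd.sub hκ).sub (h11.smul hN'))).congr_fderiv ?_
    refine ContinuousLinearMap.ext fun x ↦ ?_
    refine Prod.ext rfl ?_
    simp [f', T, q₀, c, sub_sub]
  have hGq₀ : G q₀ = ((0, p₀), 0) := by simp [G, q₀]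
  obtain ⟨g, hg0, hg1, hg2, hg3⟩ := exists_smooth_inverse (.of_forall fun _ ↦ hG.contDiffAt) hG'
  rw [hGq₀] at hg0 hg1 hg2
  let ι : ℝ × P → (ℝ × P) × C := fun x ↦ (x, 0)
  have hι : ContDiff ℝ ∞ ι := contDiff_id.prodMk contDiff_const
  have hιt : Filter.Tendsto ι (𝓝 (0, p₀)) (𝓝 ((0, p₀), 0)) := hι.continuous.continuousAt
  refine ⟨fun x ↦ (g (ι x)).2, by simp [ι, hg0, q₀, κ]; rfl, ?_, ?_, ?_⟩
  · filter_upwards [hιt.eventually hg1] with x hx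
    exact contDiffAt_snd.comp x (hx.comp x hι.contDiffAt)
  · filter_upwards [hιt.eventually hg2] with x hx
    have h1 : (g (ι x)).1 = x := congrArg Prod.fst hx
    have h2 : (g (ι x)).2 - κ (g (ι x)).1.2 - (g (ι x)).1.1 • N (g (ι x)).2 = 0 :=
      congrArg Prod.snd hx
    rw [h1, sub_sub, sub_eq_zero] at h2
    exact h2
  · filter_upwards [hg3] with q hq hq'
    have : G q = ι q.1 := by
      refine Prod.ext rfl ?_
      change q.2 - κ q.1.2 - q.1.1 • N q.2 = 0
      rw [sub_sub, sub_eq_zero]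
      exact hq'
    rw [← this, hq]

/-- The local flow of a smooth vector field is smooth. -/
theorem exists_smooth_flow {v : P → P} (hv : ContDiff ℝ ∞ v) (p₀ : P) :
    ∃ Φ : ℝ × P → P, (∀ᶠ x in 𝓝 (0, p₀), ContDiffAt ℝ ∞ Φ x) ∧
      (∀ᶠ p in 𝓝 p₀, Φ (0, p) = p) ∧
      ∀ᶠ x in 𝓝 (0, p₀), HasDerivAt (fun h ↦ Φ (h, x.2)) (v (Φ x)) x.1 := by
  obtain ⟨Γ, hΓ0, hΓs, hΓe, hΓu⟩ := exists_smooth_solution_integral_eq ⟨v, hv.continuous⟩ hv p₀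
  have h1m : (1 : ℝ) ∈ Set.Icc (-1 : ℝ) 1 := by norm_num
  -- `Γ (h, p)` is the trajectory from `p` run at speed `h`, so its value at `1` is the flow at time
  -- `h`.
  refine ⟨fun x ↦ Γ x ⟨1, h1m⟩, ?_, ?_, ?_⟩
  · filter_upwards [hΓs] with x hx
    exact (ContinuousMap.evalCLM ℝ (⟨1, h1m⟩ : Set.Icc (-1 : ℝ) 1)).contDiff.contDiffAt.comp x hx
  · have : Filter.Tendsto (fun p : P ↦ ((0 : ℝ), p)) (𝓝 p₀) (𝓝 (0, p₀)) :=
      (by fun_prop : Continuous fun p : P ↦ ((0 : ℝ), p)).continuousAt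
    filter_upwards [this.eventually hΓe] with p hp
    rw [hp]
    simp
  obtain ⟨δ, hδ, hu⟩ := Metric.eventually_nhds_iff_ball.1 hΓu
  have hcont : ∀ᶠ x in 𝓝 (0, p₀), dist (Γ x) (.const _ p₀) < δ := by
    have := (hΓs.self_of_nhds.continuousAt).eventually (Metric.ball_mem_nhds _ hδ)
    rwa [hΓ0] at this
  obtain ⟨ε, hε, hlt⟩ := Metric.eventually_nhds_iff_ball.1 (hcont.and hΓe)
  set η := min ε δ / 2 with hη
  have hη0 : 0 < η := by positivity
  have hηε : η < ε := by have := min_le_left ε δ; linarith [lt_min hε hδ]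
  have hηδ : η < δ := by have := min_le_right ε δ; linarith [lt_min hε hδ]
  -- With `η` fixed, `h` enters only through the upper limit of an integral, so the time derivative
  -- follows from the fundamental theorem of calculus.
  have key : ∀ h p, |h| < η → dist p p₀ < η →
      Γ (h, p) ⟨1, h1m⟩ = p + η • ∫ s in (0 : ℝ)..(h / η), v (extendUnit (Γ (η, p)) s) := by
    intro h p hh hp
    obtain ⟨hd, he⟩ := hlt (η, p) (by
      rw [Metric.mem_ball, Prod.dist_eq, Real.dist_eq, sub_zero, abs_of_pos hη0]
      exact max_lt hηε (hp.trans hηε))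
    set β₀ := Γ (η, p)
    have ht : |h / η| ≤ 1 := by
      rw [abs_div, abs_of_pos hη0, div_le_one hη0]
      exact hh.le
    have hts : ∀ s ∈ Set.Icc (-1 : ℝ) 1, h / η * s ∈ Set.Icc (-1 : ℝ) 1 := by
      intro s hs
      rw [Set.mem_Icc, ← abs_le] at hs
      rw [Set.mem_Icc, ← abs_le, abs_mul]
      exact mul_le_one₀ ht (abs_nonneg _) hs
    have he' : ∀ s : Set.Icc (-1 : ℝ) 1,
        β₀ s = p + η • ∫ s in (0 : ℝ)..s, v (extendUnit β₀ s) := by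
      intro s
      conv_lhs => rw [he]
      rfl
    -- Rescaling time by `h / η` turns the solution of speed `η` into one of speed `h`; local
    -- uniqueness identifies it with `Γ (h, p)`.
    let β : C(Set.Icc (-1 : ℝ) 1, P) := ⟨fun s ↦ β₀ ⟨h / η * s, hts s s.2⟩, by fun_prop⟩
    have hβ : β = Γ (h, p) := by
      refine hu ((h, p), β) ?_ ?_
      · rw [Metric.mem_ball, Prod.dist_eq, Prod.dist_eq, Real.dist_eq, sub_zero]
        refine max_lt (max_lt (hh.trans hηδ) (hp.trans hηδ)) ?_
        rw [ContinuousMap.dist_lt_iff hδ] at hd ⊢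
        exact fun s ↦ hd _
      · ext s
        change β₀ ⟨h / η * s, hts s s.2⟩ = p + h • ∫ τ in (0 : ℝ)..s, v (extendUnit β τ)
        rw [he']
        congr 1
        have h1 := intervalIntegral.smul_integral_comp_mul_left (a := 0) (b := s)
          (fun τ ↦ v (extendUnit β₀ τ)) (h / η)
        rw [mul_zero] at h1
        rw [← h1, smul_smul, mul_div_cancel₀ h hη0.ne']
        congr 1
        refine intervalIntegral.integral_congr fun τ hτ ↦ ?_
        have hτ' : τ ∈ Set.Icc (-1 : ℝ) 1 :=
          (Set.uIcc_subset_Icc (by norm_num) s.2) hτ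
        rw [extendUnit_of_mem _ hτ', extendUnit_of_mem _ (hts τ hτ')]
        rfl
    rw [← hβ]
    change β₀ ⟨h / η * 1, _⟩ = _
    rw [he']
    simp
  filter_upwards [Metric.ball_mem_nhds ((0 : ℝ), p₀) hη0] with x hx
  rw [Metric.mem_ball, Prod.dist_eq, Real.dist_eq, sub_zero, max_lt_iff] at hx
  obtain ⟨h, p⟩ := x
  obtain ⟨hh, hp⟩ := hx
  simp only at hh hp ⊢
  have hnear : (fun h ↦ Γ (h, p) ⟨1, h1m⟩) =ᶠ[𝓝 h] fun h ↦
      p + η • ∫ s in (0 : ℝ)..(h / η), v (extendUnit (Γ (η, p)) s) := by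
    have : ∀ᶠ h' in 𝓝 h, |h'| < η := continuous_abs.continuousAt.eventually_lt_const hh
    filter_upwards [this] with h' hh'
    exact key h' p hh' hp
  have hc : Continuous fun s ↦ v (extendUnit (Γ (η, p)) s) :=
    hv.continuous.comp (extendUnit _).continuous
  have hder : HasDerivAt (fun t ↦ ∫ s in (0 : ℝ)..t, v (extendUnit (Γ (η, p)) s))
      (v (extendUnit (Γ (η, p)) (h / η))) (h / η) :=
    intervalIntegral.integral_hasDerivAt_right (hc.intervalIntegrable _ _)
      hc.aestronglyMeasurable.stronglyMeasurableAtFilter hc.continuousAt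
  have hval : extendUnit (Γ (η, p)) (h / η) = Γ (h, p) ⟨1, h1m⟩ := by
    have hmem : h / η ∈ Set.Icc (-1 : ℝ) 1 := by
      rw [Set.mem_Icc, ← abs_le, abs_div, abs_of_pos hη0, div_le_one hη0]
      exact hh.le
    rw [key h p hh hp, extendUnit_of_mem _ hmem]
    have he := (hlt (η, p) (by
      rw [Metric.mem_ball, Prod.dist_eq, Real.dist_eq, sub_zero, abs_of_pos hη0]
      exact max_lt hηε (hp.trans hηε))).2
    conv_lhs => rw [he]
    rfl
  rw [hval] at hder
  have := ((hder.scomp h ((hasDerivAt_id h).div_const η)).const_smul η).const_add p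
  refine (this.congr_of_eventuallyEq hnear).congr_deriv ?_
  rw [smul_smul, mul_one_div_cancel hη0.ne', one_smul]

end Flow

/-! ### Quasilinear first-order systems by characteristics. -/

section Characteristics

variable {E A : Type*} [NormedAddCommGroup E] [NormedSpace ℝ E] [FiniteDimensional ℝ E]
  [NormedAddCommGroup A] [NormedSpace ℝ A] [FiniteDimensional ℝ A]

/-- The quasilinear equation `Du(x) V(x, u x) = W(x, u x)` has a local smooth solution with a
prescribed value at a point where the equation is not degenerate. -/
theorem exists_smooth_solution_quasilinear {V : E × A → E} {W : E × A → A} {x₀ : E} {c : A}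
    (hV : ∀ᶠ q in 𝓝 (x₀, c), ContDiffAt ℝ ∞ V q) (hW : ∀ᶠ q in 𝓝 (x₀, c), ContDiffAt ℝ ∞ W q)
    (hV0 : V (x₀, c) ≠ 0) :
    ∃ u : E → A, u x₀ = c ∧ (∀ᶠ x in 𝓝 x₀, ContDiffAt ℝ ∞ u x) ∧
      ∀ᶠ x in 𝓝 x₀, fderiv ℝ u x (V (x, u x)) = W (x, u x) := by
  have : CompleteSpace E := FiniteDimensional.complete ℝ E
  have : CompleteSpace A := FiniteDimensional.complete ℝ A
  obtain ⟨w, hw, hwe⟩ := exists_contDiff_eventuallyEq (v := fun q ↦ (V q, W q))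
    ((hV.and hW).mono fun q hq ↦ hq.1.prodMk hq.2)
  obtain ⟨Φ, hΦs, hΦ0, hΦd⟩ := exists_smooth_flow hw (x₀, c)
  set V₀ := V (x₀, c) with hV₀
  obtain ⟨ℓ, hℓ⟩ := SeparatingDual.exists_eq_one (R := ℝ) hV0
  -- Since `ℓ V₀ = 1`, a point `z` splits into a time `ℓ (z - x₀)` and a starting point on the
  -- hyperplane `ℓ = ℓ x₀`, where the initial value is the constant `c`.
  let ζ : E → ℝ × (E × A) := fun z ↦ (ℓ (z - x₀), (z - ℓ (z - x₀) • V₀, c))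
  let ζ' : E →L[ℝ] ℝ × (E × A) := ℓ.prod ((.id ℝ E - ℓ.smulRight V₀).prod 0)
  have hζ0 : ζ x₀ = (0, (x₀, c)) := by simp [ζ]
  have hζd : ∀ z, HasFDerivAt ζ ζ' z := by
    intro z
    have h1 : HasFDerivAt (fun z ↦ ℓ (z - x₀)) ℓ z :=
      ℓ.hasFDerivAt.comp z ((hasFDerivAt_id z).sub_const x₀)
    exact h1.prodMk (((hasFDerivAt_id z).sub (h1.smul_const V₀)).prodMk (hasFDerivAt_const c z))
  have hζs : ContDiff ℝ ∞ ζ := by fun_prop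
  have hζt : Filter.Tendsto ζ (𝓝 x₀) (𝓝 (0, (x₀, c))) := by
    rw [← hζ0]; exact hζs.continuous.continuousAt
  let B : E → E × A := fun z ↦ Φ (ζ z)
  have hBs : ∀ᶠ z in 𝓝 x₀, ContDiffAt ℝ ∞ B z :=
    (hζt.eventually hΦs).mono fun z hz ↦ hz.comp z hζs.contDiffAt
  have hB0 : B x₀ = (x₀, c) := by
    simp only [B, hζ0]; exact hΦ0.self_of_nhds
  have hBt : Filter.Tendsto B (𝓝 x₀) (𝓝 (x₀, c)) := by
    rw [← hB0]; exact hBs.self_of_nhds.continuousAt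
  have htime : ∀ x : ℝ × (E × A), ContDiffAt ℝ ∞ Φ x →
      HasDerivAt (fun h ↦ Φ (h, x.2)) (w (Φ x)) x.1 → fderiv ℝ Φ x (1, 0) = w (Φ x) := by
    intro x hx hd
    have h1 : HasDerivAt (fun h : ℝ ↦ (h, x.2)) ((1 : ℝ), (0 : E × A)) x.1 :=
      (hasDerivAt_id _).prodMk (hasDerivAt_const _ _)
    exact ((hx.differentiableAt (by simp)).hasFDerivAt.comp_hasDerivAt x.1 h1).unique hd
  -- Moving `z` along `V₀` changes only the time, so `B` follows the characteristic field.
  have hBV : ∀ᶠ z in 𝓝 x₀, fderiv ℝ B z V₀ = (V (B z), W (B z)) := by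
    filter_upwards [hζt.eventually hΦs, hζt.eventually hΦd, hBt.eventually hwe] with z h1 h2 h3
    have hB' : HasFDerivAt B ((fderiv ℝ Φ (ζ z)).comp ζ') z :=
      (h1.differentiableAt (by simp)).hasFDerivAt.comp z (hζd z)
    have hζV : ζ' V₀ = (1, 0) := by
      simp only [ζ', ContinuousLinearMap.prod_apply, hℓ]
      simp [hℓ]
    rw [hB'.fderiv, ContinuousLinearMap.comp_apply, hζV, htime _ h1 h2, ← h3]
  have hspace : ∀ dp : E × A, fderiv ℝ Φ (0, (x₀, c)) (0, dp) = dp := by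
    intro dp
    have h1 : HasFDerivAt (fun p : E × A ↦ ((0 : ℝ), p)) (.inr ℝ ℝ (E × A)) (x₀, c) :=
      (hasFDerivAt_const _ _).prodMk (hasFDerivAt_id _)
    have h2 := HasFDerivAt.comp (g := Φ) (x₀, c)
      (hΦs.self_of_nhds.differentiableAt (by simp)).hasFDerivAt h1
    have h3 : HasFDerivAt (Φ ∘ fun p : E × A ↦ ((0 : ℝ), p)) (.id ℝ (E × A)) (x₀, c) :=
      (hasFDerivAt_id _).congr_of_eventuallyEq hΦ0
    simpa using congrArg (fun L : E × A →L[ℝ] E × A ↦ L dp) (h2.unique h3)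
  -- At time `0` the flow is the identity in space and has velocity `V₀` in the base; the splitting
  -- `ζ` recombines these into the identity.
  have hΘ : HasFDerivAt (fun z ↦ (B z).1) (ContinuousLinearEquiv.refl ℝ E : E →L[ℝ] E) x₀ := by
    have hΦ' := (hΦs.self_of_nhds.differentiableAt (by simp)).hasFDerivAt
    rw [← hζ0] at hΦ'
    have hB' := hΦ'.comp x₀ (hζd x₀)
    refine ((hasFDerivAt_fst (𝕜 := ℝ) (E := E) (F := A) (p := B x₀)).comp x₀ hB').congr_fderiv ?_
    ext z
    have hsplit : ζ' z = ℓ z • ((1 : ℝ), (0 : E × A)) + (0, (z - ℓ z • V₀, 0)) := by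
      ext <;> simp [ζ']
    have ht := htime _ hΦs.self_of_nhds hΦd.self_of_nhds
    rw [hΦ0.self_of_nhds, hwe.self_of_nhds] at ht
    rw [ContinuousLinearMap.comp_apply, ContinuousLinearMap.comp_apply, hsplit, hζ0, map_add,
      map_smul, ht, hspace]
    simp [← hV₀]
  have hΘs : ∀ᶠ z in 𝓝 x₀, ContDiffAt ℝ ∞ (fun z ↦ (B z).1) z :=
    hBs.mono fun z hz ↦ contDiffAt_fst.comp z hz
  have hΨs : ∀ᶠ z in 𝓝 x₀, ContDiffAt ℝ ∞ (fun z ↦ (B z).2) z :=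
    hBs.mono fun z hz ↦ contDiffAt_snd.comp z hz
  obtain ⟨g, hg0, hgs, hg1, hg2⟩ := exists_smooth_inverse hΘs hΘ
  simp only [hB0] at hg0 hgs hg1
  have hgt : Filter.Tendsto g (𝓝 x₀) (𝓝 x₀) := by
    have := hgs.self_of_nhds.continuousAt.tendsto
    rwa [hg0] at this
  have hus : ∀ᶠ x in 𝓝 x₀, ContDiffAt ℝ ∞ (fun x ↦ (B (g x)).2) x := by
    filter_upwards [hgs, hgt.eventually hΨs] with x h1 h2
    exact h2.comp x h1
  -- The characteristics sweep out the graph of `u`: the value component is read off after inverting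
  -- the base component. Differentiating `u ((B z).1) = (B z).2` along `V₀` gives the equation.
  refine ⟨fun x ↦ (B (g x)).2, by simp only [hg0, hB0], hus, ?_⟩
  filter_upwards [hg1, hgt.eventually hBs, hus, hgt.eventually hg2.eventually_nhds,
    hgt.eventually hBV] with x h1 h2 h3 h4 h5
  set z := g x with hz
  have hBz := (h2.differentiableAt (by simp)).hasFDerivAt
  have hΘz : HasFDerivAt (fun z ↦ (B z).1) ((ContinuousLinearMap.fst ℝ E A).comp (fderiv ℝ B z)) z :=
    hasFDerivAt_fst.comp z hBz
  have hΨz : HasFDerivAt (fun z ↦ (B z).2) ((ContinuousLinearMap.snd ℝ E A).comp (fderiv ℝ B z)) z :=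
    hasFDerivAt_snd.comp z hBz
  have hu := (h3.differentiableAt (by simp)).hasFDerivAt
  rw [← h1] at hu
  have hcomp := HasFDerivAt.comp (g := fun x ↦ (B (g x)).2) z hu hΘz
  have heq : ((fun x ↦ (B (g x)).2) ∘ fun z ↦ (B z).1) =ᶠ[𝓝 z] fun z ↦ (B z).2 :=
    h4.mono fun y hy ↦ by simp only [Function.comp_apply, hy]
  have := congrArg (fun L : E →L[ℝ] A ↦ L V₀)
    ((hcomp.congr_of_eventuallyEq heq.symm).unique hΨz)
  simp only [ContinuousLinearMap.comp_apply, h5, ContinuousLinearMap.coe_fst',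
    ContinuousLinearMap.coe_snd'] at this
  rw [h1] at this
  have hBx : B z = (x, (B z).2) := Prod.ext h1 rfl
  rw [← hBx]
  exact this

end Characteristics

/-! ### Gram matrices and orthogonal projection. -/

/-- The orthogonal projection onto the span of a linearly independent family, in terms of the
inverse of its Gram matrix. -/
theorem starProjection_eq_sum_gram_inv {V : Type*} [NormedAddCommGroup V] [InnerProductSpace ℝ V]
    {k : ℕ} {X : Fin k → V} (hX : LinearIndependent ℝ X) (K : Submodule ℝ V)
    [K.HasOrthogonalProjection] (hK : Submodule.span ℝ (Set.range X) = K) (w : V) :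
    K.starProjection w
      = ∑ j, (∑ m, (Matrix.gram ℝ X)⁻¹ j m * inner ℝ w (X m)) • X j := by
  have hdet : IsUnit (Matrix.gram ℝ X).det :=
    isUnit_iff_ne_zero.2 (Matrix.det_gram_ne_zero_iff_linearIndependent.2 hX)
  have hmem : ∀ j, X j ∈ K := fun j ↦ hK ▸ Submodule.subset_span ⟨j, rfl⟩
  refine (Submodule.eq_starProjection_of_mem_orthogonal
    (K.sum_mem fun j _ ↦ K.smul_mem _ (hmem j)) ?_)
  rw [← hK, Submodule.mem_orthogonal]
  intro u hu
  induction hu using Submodule.span_induction with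
  | zero => simp
  | add u v _ _ hu hv => rw [inner_add_left, hu, hv, add_zero]
  | smul c u _ hu => rw [real_inner_smul_left, hu, mul_zero]
  | mem u hu =>
    obtain ⟨l, rfl⟩ := hu
    have h := congrFun (congrArg (fun A : Matrix (Fin k) (Fin k) ℝ ↦
      A.mulVec fun m ↦ inner ℝ w (X m)) (Matrix.mul_nonsing_inv _ hdet)) l
    simp only [← Matrix.mulVec_mulVec, Matrix.one_mulVec] at h
    rw [inner_sub_right, inner_sum, real_inner_comm, ← h, sub_eq_zero]
    simp only [Matrix.mulVec, dotProduct, Matrix.gram_apply, real_inner_smul_right, mul_comm]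

/-- By Cramer's rule the entries of the inverse are polynomials divided by the determinant. -/
theorem contDiffAt_matrix_inv_apply {k : ℕ} {A : Fin k → Fin k → ℝ} (hA : (Matrix.of A).det ≠ 0)
    (i j : Fin k) : ContDiffAt ℝ ∞ (fun B : Fin k → Fin k → ℝ ↦ (Matrix.of B)⁻¹ i j) A := by
  have hdet : ContDiff ℝ ∞ fun B : Fin k → Fin k → ℝ ↦ (Matrix.of B).det := by
    simp only [Matrix.det_apply, Matrix.of_apply]
    fun_prop
  have hadj : ContDiff ℝ ∞ fun B : Fin k → Fin k → ℝ ↦ (Matrix.of B).adjugate i j := by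
    simp only [Matrix.adjugate_apply, Matrix.det_apply]
    refine ContDiff.sum fun σ _ ↦ ContDiff.const_smul _ (contDiff_prod fun l _ ↦ ?_)
    by_cases h : σ l = j
    · simp only [h, Matrix.updateRow_self]
      exact contDiff_const
    · simp only [Matrix.updateRow_ne h, Matrix.of_apply]
      fun_prop
  simp only [Matrix.inv_def, Matrix.smul_apply, Ring.inverse_eq_inv', smul_eq_mul]
  exact (hdet.contDiffAt.inv hA).mul hadj.contDiffAt

/-! ### Smoothness of brackets, Koszul terms and Christoffel symbols. -/

section SmoothFields

variable {E : Type*} [NormedAddCommGroup E] [NormedSpace ℝ E]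
  {M : Type*} [TopologicalSpace M] [ChartedSpace E M] [IsManifold 𝓘(ℝ, E) ∞ M]

/-- The derivative of a smooth function along a smooth vector field is smooth. -/
theorem contMDiffOn_mvfderiv_apply {F : Type*} [NormedAddCommGroup F] [NormedSpace ℝ F]
    {f : M → F} {X : Π x : M, TangentSpace 𝓘(ℝ, E) x} {U : Set M} (hU : IsOpen U)
    (hf : ContMDiffOn 𝓘(ℝ, E) 𝓘(ℝ, F) ∞ f U)
    (hX : ContMDiffOn 𝓘(ℝ, E) 𝓘(ℝ, E).tangent ∞ (fun x ↦ (⟨x, X x⟩ : TangentBundle 𝓘(ℝ, E) M)) U) :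
    ContMDiffOn 𝓘(ℝ, E) 𝓘(ℝ, F) ∞ (fun x ↦ mvfderiv 𝓘(ℝ, E) f x (X x)) U := by
  have h1 : IsManifold 𝓘(ℝ, E) 1 M := .of_le (n := ∞) (mod_cast le_top)
  have h := (hf.contMDiffOn_tangentMapWithin (m := ∞) (by simp) hU.uniqueMDiffOn).comp hX
    (fun x hx ↦ hx)
  refine ((contMDiff_snd_tangentBundle_modelSpace F 𝓘(ℝ, F)).comp_contMDiffOn h).congr ?_
  intro x hx
  change _ = mfderivWithin 𝓘(ℝ, E) 𝓘(ℝ, F) f U x (X x)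
  rw [mfderivWithin_of_isOpen hU hx]
  rfl

theorem contMDiffOn_mlieBracket [FiniteDimensional ℝ E]
    {X Y : Π x : M, TangentSpace 𝓘(ℝ, E) x} {U : Set M} (hU : IsOpen U)
    (hX : ContMDiffOn 𝓘(ℝ, E) 𝓘(ℝ, E).tangent ∞ (fun x ↦ (⟨x, X x⟩ : TangentBundle 𝓘(ℝ, E) M)) U)
    (hY : ContMDiffOn 𝓘(ℝ, E) 𝓘(ℝ, E).tangent ∞ (fun x ↦ (⟨x, Y x⟩ : TangentBundle 𝓘(ℝ, E) M)) U) :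
    ContMDiffOn 𝓘(ℝ, E) 𝓘(ℝ, E).tangent ∞
      (fun x ↦ (⟨x, mlieBracket 𝓘(ℝ, E) X Y x⟩ : TangentBundle 𝓘(ℝ, E) M)) U := by
  have : CompleteSpace E := FiniteDimensional.complete ℝ E
  have h2 : IsManifold 𝓘(ℝ, E) (minSmoothness ℝ 2) M := by
    rw [minSmoothness_of_isRCLikeNormedField]
    exact .of_le (n := ∞) (WithTop.coe_le_coe.2 le_top)
  have h3 : IsManifold 𝓘(ℝ, E) (((⊤ : ℕ∞) : WithTop ℕ∞) + 1) M := by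
    rwa [show (((⊤ : ℕ∞) : WithTop ℕ∞) + 1) = ∞ from rfl]
  intro x hx
  refine (ContMDiffAt.mlieBracket_vectorField (m := ⊤) (n := ⊤)
    ((hX x hx).contMDiffAt (hU.mem_nhds hx)) ((hY x hx).contMDiffAt (hU.mem_nhds hx))
    ?_).contMDiffWithinAt
  rw [minSmoothness_of_isRCLikeNormedField]
  rfl

variable {k : ℕ}

theorem IsFrameOn.contMDiffAt {S : Π x : M, Submodule ℝ (TangentSpace 𝓘(ℝ, E) x)}
    {X : Fin k → Π x : M, TangentSpace 𝓘(ℝ, E) x} {U : Set M} (hX : IsFrameOn S X U)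
    (hU : IsOpen U) {x : M} (hx : x ∈ U) (i : Fin k) :
    ContMDiffAt 𝓘(ℝ, E) 𝓘(ℝ, E).tangent ∞ (fun x ↦ (⟨x, X i x⟩ : TangentBundle 𝓘(ℝ, E) M)) x :=
  (hX.contMDiffOn i x hx).contMDiffAt (hU.mem_nhds hx)

theorem IsFrameOn.mem {S : Π x : M, Submodule ℝ (TangentSpace 𝓘(ℝ, E) x)}
    {X : Fin k → Π x : M, TangentSpace 𝓘(ℝ, E) x} {U : Set M} (hX : IsFrameOn S X U)
    {x : M} (hx : x ∈ U) (i : Fin k) : X i x ∈ S x :=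
  hX.span_eq x hx ▸ Submodule.subset_span ⟨i, rfl⟩

theorem contMDiffAt_sum_smul {ι : Type*} (s : Finset ι) {X : ι → Π x : M, TangentSpace 𝓘(ℝ, E) x}
    {a : ι → M → ℝ} {x : M} (ha : ∀ j ∈ s, ContMDiffAt 𝓘(ℝ, E) 𝓘(ℝ, ℝ) ∞ (a j) x)
    (hX : ∀ j ∈ s, ContMDiffAt 𝓘(ℝ, E) 𝓘(ℝ, E).tangent ∞
      (fun x ↦ (⟨x, X j x⟩ : TangentBundle 𝓘(ℝ, E) M)) x) :
    ContMDiffAt 𝓘(ℝ, E) 𝓘(ℝ, E).tangent ∞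
      (fun x ↦ (⟨x, ∑ j ∈ s, a j x • X j x⟩ : TangentBundle 𝓘(ℝ, E) M)) x :=
  ContMDiffAt.sum_section fun j hj ↦ (ha j hj).smul_section (hX j hj)

variable [RiemannianBundle (fun x : M ↦ TangentSpace 𝓘(ℝ, E) x)]
  [IsContMDiffRiemannianBundle 𝓘(ℝ, E) ∞ E (fun x : M ↦ TangentSpace 𝓘(ℝ, E) x)]

theorem contMDiffOn_inner {X Y : Π x : M, TangentSpace 𝓘(ℝ, E) x} {U : Set M}
    (hX : ContMDiffOn 𝓘(ℝ, E) 𝓘(ℝ, E).tangent ∞ (fun x ↦ (⟨x, X x⟩ : TangentBundle 𝓘(ℝ, E) M)) U)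
    (hY : ContMDiffOn 𝓘(ℝ, E) 𝓘(ℝ, E).tangent ∞ (fun x ↦ (⟨x, Y x⟩ : TangentBundle 𝓘(ℝ, E) M)) U) :
    ContMDiffOn 𝓘(ℝ, E) 𝓘(ℝ, ℝ) ∞ (fun x ↦ (inner ℝ (X x) (Y x) : ℝ)) U :=
  ContMDiffOn.inner_bundle (IB := 𝓘(ℝ, E)) (F := E)
    (E := fun x : M ↦ TangentSpace 𝓘(ℝ, E) x) (b := fun x ↦ x) hX hY

variable [FiniteDimensional ℝ E]

theorem contMDiffOn_koszul {X Y Z : Π x : M, TangentSpace 𝓘(ℝ, E) x} {U : Set M} (hU : IsOpen U)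
    (hX : ContMDiffOn 𝓘(ℝ, E) 𝓘(ℝ, E).tangent ∞ (fun x ↦ (⟨x, X x⟩ : TangentBundle 𝓘(ℝ, E) M)) U)
    (hY : ContMDiffOn 𝓘(ℝ, E) 𝓘(ℝ, E).tangent ∞ (fun x ↦ (⟨x, Y x⟩ : TangentBundle 𝓘(ℝ, E) M)) U)
    (hZ : ContMDiffOn 𝓘(ℝ, E) 𝓘(ℝ, E).tangent ∞ (fun x ↦ (⟨x, Z x⟩ : TangentBundle 𝓘(ℝ, E) M)) U) :
    ContMDiffOn 𝓘(ℝ, E) 𝓘(ℝ, ℝ) ∞ (koszul 𝓘(ℝ, E) X Y Z) U := by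
  have hd {A B C : Π x : M, TangentSpace 𝓘(ℝ, E) x} (hA) (hB) (hC) :=
    contMDiffOn_mvfderiv_apply hU (contMDiffOn_inner (X := A) (Y := B) (U := U) hA hB) (X := C) hC
  have hb {A B C : Π x : M, TangentSpace 𝓘(ℝ, E) x} (hA) (hB) (hC) :=
    contMDiffOn_inner (contMDiffOn_mlieBracket hU (X := A) (Y := B) hA hB) (Y := C) hC
  unfold koszul
  exact contMDiffOn_const.mul ((((((hd hY hZ hX).add (hd hX hZ hY)).sub (hd hX hY hZ)).add
    (hb hX hY hZ)).sub (hb hX hZ hY)).sub (hb hY hZ hX))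

/-- The Christoffel symbols of the horizontal connection in a smooth frame are smooth. -/
theorem exists_smooth_christoffel (S : SmoothDistribution 𝓘(ℝ, E) M k)
    {X : Fin k → Π x : M, TangentSpace 𝓘(ℝ, E) x} {U : Set M} (hU : IsOpen U)
    (hX : IsFrameOn S.fiber X U) :
    ∃ Γ : Fin k → Fin k → Fin k → M → ℝ,
      (∀ i l j, ContMDiffOn 𝓘(ℝ, E) 𝓘(ℝ, ℝ) ∞ (Γ i l j) U) ∧
      ∀ x ∈ U, ∀ i l, horizontalConnection S (X l) x (X i x) = ∑ j, Γ i l j x • X j x := by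
  -- The Koszul expression gives `⟨∇_{X_i} X_l, X_m⟩`; the inverse Gram matrix converts these
  -- products into coefficients of the projection.
  refine ⟨fun i l j x ↦ ∑ m, (Matrix.gram ℝ fun n ↦ X n x)⁻¹ j m
    * koszul 𝓘(ℝ, E) (X i) (X l) (X m) x, fun i l j ↦ ?_, fun x hx i l ↦ ?_⟩
  · refine contMDiffOn_finsetSum fun m _ ↦ ContMDiffOn.mul (fun x hx ↦ ?_)
      (contMDiffOn_koszul hU (hX.contMDiffOn i) (hX.contMDiffOn l) (hX.contMDiffOn m))
    have hG : ContMDiffWithinAt 𝓘(ℝ, E) 𝓘(ℝ, Fin k → Fin k → ℝ) ∞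
        (fun x i j ↦ (inner ℝ (X i x) (X j x) : ℝ)) U x :=
      contMDiffWithinAt_pi_space.2 fun i ↦ contMDiffWithinAt_pi_space.2 fun j ↦
        contMDiffOn_inner (hX.contMDiffOn i) (hX.contMDiffOn j) x hx
    exact (contDiffAt_matrix_inv_apply (Matrix.det_gram_ne_zero_iff_linearIndependent.2
      (hX.linearIndependent x hx)) j m).comp_contMDiffWithinAt hG
  · rw [horizontalConnection, starProjection_eq_sum_gram_inv (hX.linearIndependent x hx) _
      (hX.span_eq x hx)]
    have hd (i) := (hX.contMDiffAt hU hx i).mdifferentiableAt (by simp)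
    refine Finset.sum_congr rfl fun j _ ↦ ?_
    congr 1
    refine Finset.sum_congr rfl fun m _ ↦ ?_
    congr 1
    exact inner_leviCivitaFun_eq_koszul (hd i) (hd l) (hd m)

theorem leviCivita_sum_smul {ι : Type*} (s : Finset ι) {X : ι → Π x : M, TangentSpace 𝓘(ℝ, E) x}
    {a : ι → M → ℝ} {x : M} (ha : ∀ j ∈ s, ContMDiffAt 𝓘(ℝ, E) 𝓘(ℝ, ℝ) ∞ (a j) x)
    (hX : ∀ j ∈ s, ContMDiffAt 𝓘(ℝ, E) 𝓘(ℝ, E).tangent ∞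
      (fun x ↦ (⟨x, X j x⟩ : TangentBundle 𝓘(ℝ, E) M)) x) (v : TangentSpace 𝓘(ℝ, E) x) :
    leviCivita 𝓘(ℝ, E) M (fun x ↦ ∑ j ∈ s, a j x • X j x) x v
      = ∑ j ∈ s, (a j x • leviCivita 𝓘(ℝ, E) M (X j) x v
        + mvfderiv 𝓘(ℝ, E) (a j) x v • X j x) := by
  classical
  induction s using Finset.induction_on with
  | empty =>
    have := congrFun (leviCivita 𝓘(ℝ, E) M).zero x
    simp only [Finset.sum_empty]
    exact congrArg (fun L ↦ L v) this
  | insert j s hj ih =>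
    have ha' := fun i hi ↦ ha i (Finset.mem_insert_of_mem hi)
    have hX' := fun i hi ↦ hX i (Finset.mem_insert_of_mem hi)
    have haj := (ha j (Finset.mem_insert_self _ _)).mdifferentiableAt (by simp)
    have hXj := (hX j (Finset.mem_insert_self _ _)).mdifferentiableAt (by simp)
    have hs := (contMDiffAt_sum_smul s ha' hX').mdifferentiableAt (by simp)
    have hcov := (leviCivita 𝓘(ℝ, E) M).isCovariantDerivativeOnUniv
    have hsum : (fun x ↦ ∑ i ∈ insert j s, a i x • X i x)
        = a j • X j + fun x ↦ ∑ i ∈ s, a i x • X i x := by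
      ext1 x
      simp [Finset.sum_insert hj]
    rw [hsum, Finset.sum_insert hj, ← ih ha' hX']
    have h1 := hcov.add (haj.smul_section hXj) hs
    have h2 := hcov.leibniz hXj haj
    rw [h2] at h1
    exact congrArg (fun L ↦ L v) h1

end SmoothFields

/-! ### Horizontal fields with `D_Y Y = 0`. -/

section GeodesicFields

variable {E : Type*} [NormedAddCommGroup E] [NormedSpace ℝ E]
  {M : Type*} [TopologicalSpace M] [ChartedSpace E M] [IsManifold 𝓘(ℝ, E) ∞ M]

theorem eventually_contDiffAt_comp_extChartAt_symm {F : Type*} [NormedAddCommGroup F]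
    [NormedSpace ℝ F] {g : M → F} {U : Set M} (hU : IsOpen U)
    (hg : ContMDiffOn 𝓘(ℝ, E) 𝓘(ℝ, F) ∞ g U) {y : M} (hy : y ∈ U) :
    ∀ᶠ z in 𝓝 (extChartAt 𝓘(ℝ, E) y y),
      ContDiffAt ℝ ∞ (fun z ↦ g ((extChartAt 𝓘(ℝ, E) y).symm z)) z := by
  have hO : IsOpen ((extChartAt 𝓘(ℝ, E) y).target ∩ (extChartAt 𝓘(ℝ, E) y).symm ⁻¹' U) :=
    (continuousOn_extChartAt_symm y).isOpen_inter_preimage (isOpen_extChartAt_target y) hU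
  have hs := (hg.comp' (contMDiffOn_extChartAt_symm (I := 𝓘(ℝ, E)) (n := ∞) y)).contDiffOn
  filter_upwards [hO.mem_nhds ⟨mem_extChartAt_target y, by simpa using hy⟩] with z hz
  exact (hs z hz).contDiffAt (hO.mem_nhds hz)

theorem mvfderiv_comp_extChartAt {u : E → ℝ} {x y : M} (hx : x ∈ (chartAt E y).source)
    (hu : ContDiffAt ℝ ∞ u (extChartAt 𝓘(ℝ, E) y x)) (v : TangentSpace 𝓘(ℝ, E) x) :
    mvfderiv 𝓘(ℝ, E) (fun x ↦ u (extChartAt 𝓘(ℝ, E) y x)) x v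
      = fderiv ℝ u (extChartAt 𝓘(ℝ, E) y x) (mvfderiv 𝓘(ℝ, E) (extChartAt 𝓘(ℝ, E) y) x v) := by
  have h1 : MDiffAt u (extChartAt 𝓘(ℝ, E) y x) :=
    (hu.differentiableAt (by simp)).mdifferentiableAt
  have h2 := mvfderiv_comp_apply x h1
    (mdifferentiableAt_extChartAt (I := 𝓘(ℝ, E)) hx) v
  refine h2.trans ?_
  rw [mvfderiv, mfderiv_eq_fderiv]
  rfl

variable [RiemannianBundle (fun x : M ↦ TangentSpace 𝓘(ℝ, E) x)]
  [IsContMDiffRiemannianBundle 𝓘(ℝ, E) ∞ E (fun x : M ↦ TangentSpace 𝓘(ℝ, E) x)]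
  [FiniteDimensional ℝ E] {k : ℕ}

/-- The horizontal connection applied to a combination of the fields of a frame. -/
theorem horizontalConnection_sum_smul (S : SmoothDistribution 𝓘(ℝ, E) M k)
    {X : Fin k → Π x : M, TangentSpace 𝓘(ℝ, E) x} {U : Set M} (hU : IsOpen U)
    (hX : IsFrameOn S.fiber X U) {x : M} (hx : x ∈ U) {a : Fin k → M → ℝ}
    (ha : ∀ j, ContMDiffAt 𝓘(ℝ, E) 𝓘(ℝ, ℝ) ∞ (a j) x) (v : TangentSpace 𝓘(ℝ, E) x) :
    horizontalConnection S (fun x ↦ ∑ j, a j x • X j x) x v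
      = ∑ j, (a j x • horizontalConnection S (X j) x v
        + mvfderiv 𝓘(ℝ, E) (a j) x v • X j x) := by
  rw [horizontalConnection, leviCivita_sum_smul _ (fun j _ ↦ ha j)
    (fun j _ ↦ hX.contMDiffAt hU hx j), map_sum]
  refine Finset.sum_congr rfl fun j _ ↦ ?_
  rw [map_add, map_smul, map_smul, Submodule.starProjection_eq_self_iff.2 (hX.mem hx j)]
  rfl

/-- There are local horizontal fields `Y` with `D_Y Y = 0` and any nonzero horizontal value at a
given point. -/
theorem exists_geodesic_field (S : SmoothDistribution 𝓘(ℝ, E) M k)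
    {X : Fin k → Π x : M, TangentSpace 𝓘(ℝ, E) x} {U : Set M} (hU : IsOpen U)
    (hX : IsFrameOn S.fiber X U) {y : M} (hy : y ∈ U) {c : Fin k → ℝ} (hc : c ≠ 0) :
    ∃ a : Fin k → M → ℝ, (∀ j, a j y = c j) ∧ ∀ᶠ x in 𝓝 y,
      (∀ j, ContMDiffAt 𝓘(ℝ, E) 𝓘(ℝ, ℝ) ∞ (a j) x) ∧
      horizontalConnection S (fun x ↦ ∑ j, a j x • X j x) x (∑ j, a j x • X j x) = 0 := by
  obtain ⟨Γ, hΓs, hΓ⟩ := exists_smooth_christoffel S hU hX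
  set φ := extChartAt 𝓘(ℝ, E) y with hφ
  let ξ : Fin k → E → E := fun i z ↦ mvfderiv 𝓘(ℝ, E) φ (φ.symm z) (X i (φ.symm z))
  have hsrc : IsOpen (chartAt E y).source := (chartAt E y).open_source
  have hξ : ∀ i, ∀ᶠ z in 𝓝 (φ y), ContDiffAt ℝ ∞ (ξ i) z := by
    intro i
    have h := contMDiffOn_mvfderiv_apply (hU.inter hsrc)
      ((contMDiffOn_extChartAt (I := 𝓘(ℝ, E)) (n := ∞) (x := y)).mono Set.inter_subset_right)
      ((hX.contMDiffOn i).mono Set.inter_subset_left)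
    exact eventually_contDiffAt_comp_extChartAt_symm (hU.inter hsrc) h ⟨hy, mem_chart_source E y⟩
  have hΓe : ∀ i l j, ∀ᶠ z in 𝓝 (φ y), ContDiffAt ℝ ∞ (fun z ↦ Γ i l j (φ.symm z)) z :=
    fun i l j ↦ eventually_contDiffAt_comp_extChartAt_symm hU (hΓs i l j) hy
  -- In the chart, `V` is the field with coefficients `q.2`, and `W` is the quadratic Christoffel
  -- term with the sign that makes `Du(V) = W` equivalent to `D_Y Y = 0`.
  let V : E × (Fin k → ℝ) → E := fun q ↦ ∑ i, q.2 i • ξ i q.1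
  let W : E × (Fin k → ℝ) → Fin k → ℝ := fun q j ↦
    -∑ l, ∑ i, q.2 l * q.2 i * Γ i l j (φ.symm q.1)
  have hfst : Filter.Tendsto (Prod.fst : E × (Fin k → ℝ) → E) (𝓝 (φ y, c)) (𝓝 (φ y)) :=
    continuous_fst.continuousAt
  have hcoord (q : E × (Fin k → ℝ)) (i : Fin k) :
      ContDiffAt ℝ ∞ (fun q : E × (Fin k → ℝ) ↦ q.2 i) q := by fun_prop
  have hV : ∀ᶠ q in 𝓝 (φ y, c), ContDiffAt ℝ ∞ V q := by
    filter_upwards [hfst.eventually (Filter.eventually_all.2 hξ)] with q hq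
    exact ContDiffAt.sum fun i _ ↦ (hcoord q i).smul ((hq i).comp q contDiffAt_fst)
  have hW : ∀ᶠ q in 𝓝 (φ y, c), ContDiffAt ℝ ∞ W q := by
    filter_upwards [hfst.eventually (Filter.eventually_all.2 fun i ↦
      Filter.eventually_all.2 fun l ↦ Filter.eventually_all.2 (hΓe i l))] with q hq
    exact contDiffAt_pi.2 fun j ↦ (ContDiffAt.sum fun l _ ↦ ContDiffAt.sum fun i _ ↦
      ((hcoord q l).mul (hcoord q i)).mul ((hq i l j).comp q contDiffAt_fst)).neg
  have hVφ : ∀ x ∈ φ.source, ∀ b : Fin k → ℝ,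
      V (φ x, b) = mvfderiv 𝓘(ℝ, E) φ x (∑ i, b i • X i x) := by
    intro x hx b
    -- The base point `φ.symm (φ x)` occurs in the types, so it is replaced by `x` through
    -- substitution for a general `x'`.
    have h : ∀ x', x' = x → ∀ i,
        mvfderiv 𝓘(ℝ, E) φ x' (X i x') = mvfderiv 𝓘(ℝ, E) φ x (X i x) := by
      rintro x' rfl i
      rfl
    simp only [V, ξ, map_sum, map_smul, h _ (φ.left_inv hx)]
  -- The chart has invertible derivative and the frame is independent, so `c ≠ 0` suffices for a
  -- noncharacteristic start.
  have hV0 : V (φ y, c) ≠ 0 := by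
    have : IsManifold 𝓘(ℝ, E) 1 M := .of_le (n := ∞) (WithTop.coe_le_coe.2 le_top)
    rw [hVφ y (mem_extChartAt_source y)]
    intro h0
    obtain ⟨L, hL⟩ := isInvertible_mfderiv_extChartAt (I := 𝓘(ℝ, E)) (mem_extChartAt_source y)
    have h0' : L (∑ i, c i • X i y) = 0 := by
      refine Eq.trans ?_ h0
      exact congrArg (fun A ↦ A (∑ i, c i • X i y)) hL
    rw [L.map_eq_zero_iff] at h0'
    exact hc (funext (Fintype.linearIndependent_iff.1 (hX.linearIndependent y hy) c h0'))
  obtain ⟨u, hu0, hus, hue⟩ := exists_smooth_solution_quasilinear hV hW hV0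
  have hφt : Filter.Tendsto φ (𝓝 y) (𝓝 (φ y)) := continuousAt_extChartAt y
  refine ⟨fun j x ↦ u (φ x) j, fun j ↦ congrFun hu0 j, ?_⟩
  filter_upwards [hφt.eventually hus, hφt.eventually hue, hU.mem_nhds hy,
    hsrc.mem_nhds (mem_chart_source E y)] with x h1 h2 h3 h4
  have hpj (j : Fin k) : ContDiffAt ℝ ∞ (fun z ↦ u z j) (φ x) := contDiffAt_pi.1 h1 j
  have hsm (j : Fin k) : ContMDiffAt 𝓘(ℝ, E) 𝓘(ℝ, ℝ) ∞ (fun x ↦ u (φ x) j) x :=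
    (hpj j).comp_contMDiffAt (contMDiffAt_extChartAt' h4)
  refine ⟨hsm, ?_⟩
  rw [horizontalConnection_sum_smul S hU hX h3 hsm]
  have hder (j : Fin k) : mvfderiv 𝓘(ℝ, E) (fun x ↦ u (φ x) j) x (∑ i, u (φ x) i • X i x)
      = -∑ l, ∑ i, u (φ x) l * u (φ x) i * Γ i l j x := by
    rw [mvfderiv_comp_extChartAt h4 (hpj j), ← hVφ x (by rwa [extChartAt_source])]
    rw [hVφ x (by rwa [extChartAt_source])] at h2 ⊢
    have h5 := congrFun h2 j
    simp only [W, φ.left_inv (show x ∈ φ.source by rwa [extChartAt_source])] at h5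
    rw [← h5]
    have := hasFDerivAt_pi'.1 (h1.differentiableAt (by simp)).hasFDerivAt j
    rw [this.fderiv]
    rfl
  have hD (l : Fin k) : horizontalConnection S (X l) x (∑ i, u (φ x) i • X i x)
      = ∑ i, u (φ x) i • ∑ j, Γ i l j x • X j x := by
    have : ∀ v, horizontalConnection S (X l) x v
      = ((S.fiber x).starProjection.comp (leviCivita 𝓘(ℝ, E) M (X l) x)) v := fun _ ↦ rfl
    simp only [← hΓ x h3, this, map_sum, map_smul]
  simp only [hder, hD, Finset.sum_add_distrib, neg_smul, Finset.sum_neg_distrib, add_neg_eq_zero,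
    Finset.smul_sum, Finset.sum_smul, smul_smul, mul_assoc]
  conv_rhs => rw [Finset.sum_comm]
  refine Finset.sum_congr rfl fun l _ ↦ ?_
  rw [Finset.sum_comm]

end GeodesicFields

/-! ### Normalisation and unit geodesic frames. -/

section UnitGeodesicFields

variable {E : Type*} [NormedAddCommGroup E] [NormedSpace ℝ E] [FiniteDimensional ℝ E]
  {M : Type*} [TopologicalSpace M] [ChartedSpace E M] [IsManifold 𝓘(ℝ, E) ∞ M]
  [RiemannianBundle (fun x : M ↦ TangentSpace 𝓘(ℝ, E) x)]
  [IsContMDiffRiemannianBundle 𝓘(ℝ, E) ∞ E (fun x : M ↦ TangentSpace 𝓘(ℝ, E) x)] {k : ℕ}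

/-- The length of a horizontal field `Y` with `D_Y Y = 0` is constant along `Y`. -/
theorem mvfderiv_inner_self_eq_zero (S : SmoothDistribution 𝓘(ℝ, E) M k)
    {Y : Π x : M, TangentSpace 𝓘(ℝ, E) x} {x : M} (hY : MDiffAt (T% Y) x) (hYS : Y x ∈ S.fiber x)
    (hD : horizontalConnection S Y x (Y x) = 0) :
    mvfderiv 𝓘(ℝ, E) (fun x ↦ (inner ℝ (Y x) (Y x) : ℝ)) x (Y x) = 0 := by
  rw [leviCivita_metric hY hY hY, real_inner_comm (leviCivita 𝓘(ℝ, E) M Y x (Y x)) (Y x)]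
  have h : (inner ℝ (leviCivita 𝓘(ℝ, E) M Y x (Y x)) (Y x) : ℝ) = 0 := by
    -- As `Y x` is horizontal, self-adjointness of the projection replaces `∇_Y Y` by `D_Y Y` in the
    -- product.
    rw [← Submodule.starProjection_eq_self_iff.2 hYS,
      ← Submodule.inner_starProjection_left_eq_right, Submodule.starProjection_eq_self_iff.2 hYS]
    change (inner ℝ (horizontalConnection S Y x (Y x)) (Y x) : ℝ) = 0
    rw [hD, inner_zero_left]
  rw [h, add_zero]

/-- The Leibniz rule of `∇` survives projection because the projection fixes the horizontal vector
`Y x`. -/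
theorem horizontalConnection_smul (S : SmoothDistribution 𝓘(ℝ, E) M k)
    {Y : Π x : M, TangentSpace 𝓘(ℝ, E) x} {g : M → ℝ} {x : M} (hY : MDiffAt (T% Y) x)
    (hg : MDiffAt g x) (hYS : Y x ∈ S.fiber x) (v : TangentSpace 𝓘(ℝ, E) x) :
    horizontalConnection S (g • Y) x v
      = g x • horizontalConnection S Y x v + mvfderiv 𝓘(ℝ, E) g x v • Y x := by
  have h := congrArg (fun L ↦ (S.fiber x).starProjection (L v))
    ((leviCivita 𝓘(ℝ, E) M).isCovariantDerivativeOnUniv.leibniz hY hg)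
  refine h.trans ?_
  simp only [add_apply, smul_apply, ContinuousLinearMap.smulRight_apply, map_add, map_smul,
    Submodule.starProjection_eq_self_iff.2 hYS]
  rfl

/-- There are local horizontal unit fields `Y` with `D_Y Y = 0` whose value at a given point points
in any horizontal direction. -/
theorem exists_unit_geodesic_field (S : SmoothDistribution 𝓘(ℝ, E) M k)
    {X : Fin k → Π x : M, TangentSpace 𝓘(ℝ, E) x} {U : Set M} (hU : IsOpen U)
    (hX : IsFrameOn S.fiber X U) {y : M} (hy : y ∈ U) {c : Fin k → ℝ} (hc : c ≠ 0) :
    ∃ (b : Fin k → M → ℝ) (r : ℝ), r ≠ 0 ∧ (∀ j, b j y = r * c j) ∧ ∀ᶠ x in 𝓝 y,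
      (∀ j, ContMDiffAt 𝓘(ℝ, E) 𝓘(ℝ, ℝ) ∞ (b j) x) ∧
      (inner ℝ (∑ j, b j x • X j x) (∑ j, b j x • X j x) : ℝ) = 1 ∧
      horizontalConnection S (fun x ↦ ∑ j, b j x • X j x) x (∑ j, b j x • X j x) = 0 := by
  obtain ⟨a, hay, ha⟩ := exists_geodesic_field S hU hX hy hc
  let Y : Π x : M, TangentSpace 𝓘(ℝ, E) x := fun x ↦ ∑ j, a j x • X j x
  let f : M → ℝ := fun x ↦ inner ℝ (Y x) (Y x)
  let h : ℝ → ℝ := fun t ↦ (√t)⁻¹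
  have hYs : ∀ᶠ x in 𝓝 y, ContMDiffAt 𝓘(ℝ, E) 𝓘(ℝ, E).tangent ∞
      (fun x ↦ (⟨x, Y x⟩ : TangentBundle 𝓘(ℝ, E) M)) x := by
    filter_upwards [ha, hU.mem_nhds hy] with x hx hxU
    exact contMDiffAt_sum_smul _ (fun j _ ↦ hx.1 j) fun j _ ↦ hX.contMDiffAt hU hxU j
  have hfs : ∀ᶠ x in 𝓝 y, ContMDiffAt 𝓘(ℝ, E) 𝓘(ℝ, ℝ) ∞ f x := by
    filter_upwards [hYs] with x hx
    exact ContMDiffAt.inner_bundle (IB := 𝓘(ℝ, E)) (F := E)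
      (E := fun x : M ↦ TangentSpace 𝓘(ℝ, E) x) (b := fun x ↦ x) hx hx
  have hfy : 0 < f y := by
    refine real_inner_self_pos.2 fun h0 ↦ hc ?_
    have h1 := Fintype.linearIndependent_iff.1 (hX.linearIndependent y hy) _ h0
    exact funext fun j ↦ (hay j).symm.trans (h1 j)
  have hfpos : ∀ᶠ x in 𝓝 y, 0 < f x := hfs.self_of_nhds.continuousAt.eventually_const_lt hfy
  refine ⟨fun j x ↦ h (f x) * a j x, h (f y), inv_ne_zero (Real.sqrt_pos.2 hfy).ne',
    fun j ↦ by simp only [hay], ?_⟩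
  filter_upwards [ha, hYs, hfs, hfpos, hU.mem_nhds hy] with x hax hYx hfx hpos hxU
  have hh : ContDiffAt ℝ ∞ h (f x) :=
    (Real.contDiffAt_sqrt hpos.ne').inv (Real.sqrt_pos.2 hpos).ne'
  have hg : ContMDiffAt 𝓘(ℝ, E) 𝓘(ℝ, ℝ) ∞ (fun x ↦ h (f x)) x := hh.comp_contMDiffAt hfx
  have hF : (fun x ↦ ∑ j, (h (f x) * a j x) • X j x) = (fun x ↦ h (f x)) • Y := by
    ext1 x
    simp only [Y, mul_smul, ← Finset.smul_sum, Pi.smul_apply']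
  have hFx : ∑ j, (h (f x) * a j x) • X j x = h (f x) • Y x := congrFun hF x
  have hYS : Y x ∈ S.fiber x :=
    Submodule.sum_mem _ fun j _ ↦ Submodule.smul_mem _ _ (hX.mem hxU j)
  have hYd := hYx.mdifferentiableAt (by simp)
  refine ⟨fun j ↦ hg.mul (hax.1 j), ?_, ?_⟩
  · rw [hFx, real_inner_smul_left, real_inner_smul_right]
    change (√(f x))⁻¹ * ((√(f x))⁻¹ * f x) = 1
    have := (Real.sqrt_pos.2 hpos).ne'
    field_simp
    exact (Real.sq_sqrt hpos.le).symm
  · have hdf := mvfderiv_inner_self_eq_zero S hYd hYS hax.2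
    -- The normalising factor depends only on the squared length, which is constant along `Y`; hence
    -- the Leibniz term vanishes.
    have hdg : mvfderiv 𝓘(ℝ, E) (fun x ↦ h (f x)) x (Y x) = 0 := by
      refine (mvfderiv_comp_apply x (hh.differentiableAt (by simp)).mdifferentiableAt
        (hfx.mdifferentiableAt (by simp)) (Y x)).trans ?_
      rw [show mfderiv 𝓘(ℝ, E) 𝓘(ℝ, ℝ) f x (Y x) = 0 from hdf, map_zero]
    have hD : ∀ v, horizontalConnection S Y x v
      = ((S.fiber x).starProjection.comp (leviCivita 𝓘(ℝ, E) M Y x)) v := fun _ ↦ rfl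
    have hDY : horizontalConnection S Y x (Y x) = 0 := hax.2
    rw [hF, hFx, horizontalConnection_smul S hYd (hg.mdifferentiableAt (by simp)) hYS, map_smul,
      hdg, hD, map_smul, ← hD, hDY]
    simp

/-- Around every point there is a frame of unit fields `Y` with `D_Y Y = 0`. -/
theorem exists_unit_geodesic_frame (S : SmoothDistribution 𝓘(ℝ, E) M k) (y : M) :
    ∃ O : Set M, IsOpen O ∧ y ∈ O ∧ ∃ F : Fin k → Π x : M, TangentSpace 𝓘(ℝ, E) x,
      IsFrameOn S.fiber F O ∧ ∀ i, ∀ x ∈ O, (inner ℝ (F i x) (F i x) : ℝ) = 1 ∧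
        horizontalConnection S (F i) x (F i x) = 0 := by
  obtain ⟨U, hU, hy, X, hX⟩ := S.exists_frame y
  -- With the coordinate vectors as prescribed directions, the transition matrix at `y` is diagonal
  -- with nonzero entries `r i`; its determinant stays nonzero nearby.
  choose b r hr hby hb using fun i : Fin k ↦
    exists_unit_geodesic_field S hU hX hy (c := Pi.single i 1) (by simp)
  let B : M → Matrix (Fin k) (Fin k) ℝ := fun x ↦ .of fun i j ↦ b i j x
  have hBy : (B y).det ≠ 0 := by
    have : B y = Matrix.diagonal r := by
      ext i j
      simp only [B, Matrix.of_apply, hby, Matrix.diagonal_apply, Pi.single_apply]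
      aesop
    rw [this, Matrix.det_diagonal]
    exact Finset.prod_ne_zero_iff.2 fun i _ ↦ hr i
  have hBc : ContinuousAt B y := continuousAt_pi.2 fun i ↦ continuousAt_pi.2 fun j ↦
    ((hb i).self_of_nhds.1 j).continuousAt
  have hdet : ∀ᶠ x in 𝓝 y, (B x).det ≠ 0 :=
    ((continuous_id.matrix_det.continuousAt (x := B y)).comp hBc).eventually_ne hBy
  obtain ⟨O, hO, hOo, hyO⟩ := eventually_nhds_iff.1
    ((Filter.eventually_all.2 hb).and (hdet.and (hU.mem_nhds hy)))
  have hind : ∀ x ∈ O, LinearIndependent ℝ fun i ↦ ∑ j, b i j x • X j x := by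
    intro x hx
    obtain ⟨-, hd, hxU⟩ := hO x hx
    rw [Fintype.linearIndependent_iff]
    intro c h0
    simp only [Finset.smul_sum, smul_smul] at h0
    rw [Finset.sum_comm] at h0
    simp only [← Finset.sum_smul] at h0
    have h1 := Fintype.linearIndependent_iff.1 (hX.linearIndependent x hxU) _ h0
    exact congrFun (Matrix.eq_zero_of_vecMul_eq_zero hd (v := c) (funext h1))
  refine ⟨O, hOo, hyO, fun i x ↦ ∑ j, b i j x • X j x, ⟨fun i x hx ↦ ?_, hind, fun x hx ↦ ?_⟩,
    fun i x hx ↦ ((hO x hx).1 i).2⟩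
  · exact (contMDiffAt_sum_smul _ (fun j _ ↦ ((hO x hx).1 i).1 j)
      fun j _ ↦ hX.contMDiffAt hU (hO x hx).2.2 j).contMDiffWithinAt
  · have hxU := (hO x hx).2.2
    refine Submodule.eq_of_le_of_finrank_eq (Submodule.span_le.2 ?_) ?_
    · rintro _ ⟨i, rfl⟩
      exact Submodule.sum_mem _ fun j _ ↦ Submodule.smul_mem _ _ (hX.mem hxU j)
    · rw [finrank_span_eq_card (hind x hx), ← hX.span_eq x hxU,
        finrank_span_eq_card (hX.linearIndependent x hxU)]

end UnitGeodesicFields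

/-! ### Integral curves as nonholonomic geodesics. -/

section IntegralCurves

/-- Bootstrapping: if `c` is `C^n`, then so is its derivative `v ∘ c`, hence `c` is `C^(n+1)`. -/
theorem contDiffOn_of_hasDerivWithinAt_comp {E : Type*} [NormedAddCommGroup E] [NormedSpace ℝ E]
    {c : ℝ → E} {v : E → E} {D : Set E} {s : Set ℝ} (hs : UniqueDiffOn ℝ s)
    (hv : ContDiffOn ℝ ∞ v D) (hc : Set.MapsTo c s D)
    (hd : ∀ t ∈ s, HasDerivWithinAt c (v (c t)) s t) : ContDiffOn ℝ ∞ c s := by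
  refine contDiffOn_infty.2 fun n ↦ ?_
  induction n with
  | zero => exact contDiffOn_zero.2 fun t ht ↦ (hd t ht).continuousWithinAt
  | succ n ih =>
    rw [Nat.cast_add, Nat.cast_one, contDiffOn_succ_iff_derivWithin hs]
    refine ⟨fun t ht ↦ (hd t ht).differentiableWithinAt, by simp, ?_⟩
    exact ((hv.of_le (mod_cast le_top)).comp ih hc).congr
      fun t ht ↦ (hd t ht).derivWithin (hs t ht)

theorem uniqueDiffOn_of_ordConnected {J : Set ℝ} (hJ : J.OrdConnected) (hJn : J.Nontrivial) :
    UniqueDiffOn ℝ J := by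
  obtain ⟨a, ha, b, hb, hab⟩ := hJn.exists_lt
  refine uniqueDiffOn_convex hJ.convex ⟨(a + b) / 2, ?_⟩
  exact interior_maximal (Set.Ioo_subset_Icc_self.trans (hJ.out ha hb)) isOpen_Ioo
    ⟨by linarith, by linarith⟩

variable {E : Type*} [NormedAddCommGroup E] [NormedSpace ℝ E]
  {M : Type*} [TopologicalSpace M] [ChartedSpace E M] [IsManifold 𝓘(ℝ, E) ∞ M]

/-- Integral curves of smooth vector fields are smooth. -/
theorem contMDiffOn_of_isMIntegralCurveOn {X : Π x : M, TangentSpace 𝓘(ℝ, E) x} {O : Set M}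
    (hO : IsOpen O)
    (hX : ContMDiffOn 𝓘(ℝ, E) 𝓘(ℝ, E).tangent ∞ (fun x ↦ (⟨x, X x⟩ : TangentBundle 𝓘(ℝ, E) M)) O)
    {γ : ℝ → M} {J : Set ℝ} (hJ : UniqueDiffOn ℝ J) (hγO : ∀ t ∈ J, γ t ∈ O)
    (hγ : IsMIntegralCurveOn γ X J) : ContMDiffOn 𝓘(ℝ, ℝ) 𝓘(ℝ, E) ∞ γ J := by
  intro t₀ ht₀
  set φ := extChartAt 𝓘(ℝ, E) (γ t₀) with hφ
  set C := (chartAt E (γ t₀)).source with hC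
  have hCo : IsOpen C := (chartAt E (γ t₀)).open_source
  have hCφ : ∀ x ∈ C, x ∈ φ.source := fun x hx ↦ by rwa [hφ, extChartAt_source]
  have hcont : ContinuousOn γ J := fun t ht ↦ (hγ t ht).continuousWithinAt
  -- Near `t₀` the curve stays in one chart, where it solves an ODE with a smooth right-hand side;
  -- `W` cuts out these times and keeps unique differentiability.
  obtain ⟨W, hW, hJW⟩ := continuousOn_iff'.1 hcont C hCo
  have ht₀W : t₀ ∈ W := (hJW.subset ⟨mem_chart_source E (γ t₀), ht₀⟩).1
  have hC' : ∀ t ∈ J ∩ W, γ t ∈ C := fun t ht ↦ (hJW.superset ⟨ht.2, ht.1⟩).1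
  let v : E → E := fun z ↦ mvfderiv 𝓘(ℝ, E) φ (φ.symm z) (X (φ.symm z))
  have hv : ContDiffOn ℝ ∞ v (φ.target ∩ φ.symm ⁻¹' (O ∩ C)) :=
    ((contMDiffOn_mvfderiv_apply (hO.inter hCo)
      ((contMDiffOn_extChartAt (I := 𝓘(ℝ, E)) (n := ∞) (x := γ t₀)).mono Set.inter_subset_right)
      (hX.mono Set.inter_subset_left)).comp'
      (contMDiffOn_extChartAt_symm (I := 𝓘(ℝ, E)) (n := ∞) (γ t₀))).contDiffOn
  have hvφ : ∀ x ∈ C, v (φ x) = mvfderiv 𝓘(ℝ, E) φ x (X x) := by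
    intro x hx
    have h : ∀ x', x' = x → mvfderiv 𝓘(ℝ, E) φ x' (X x') = mvfderiv 𝓘(ℝ, E) φ x (X x) := by
      rintro x' rfl
      rfl
    exact h _ (φ.left_inv (hCφ x hx))
  have hs : ContDiffOn ℝ ∞ (fun t ↦ φ (γ t)) (J ∩ W) := by
    refine contDiffOn_of_hasDerivWithinAt_comp (hJ.inter hW) hv (fun t ht ↦ ?_) fun t ht ↦ ?_
    · refine ⟨φ.map_source (hCφ _ (hC' t ht)), ?_⟩
      rw [Set.mem_preimage, φ.left_inv (hCφ _ (hC' t ht))]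
      exact ⟨hγO t ht.1, hC' t ht⟩
    · have h1 := (mdifferentiableAt_extChartAt (I := 𝓘(ℝ, E)) (hC' t ht)).hasMFDerivAt
      have h2 := (h1.comp_hasMFDerivWithinAt t ((hγ t ht.1).mono (Set.inter_subset_left (t := W))))
      let A : ℝ →L[ℝ] E := (mfderiv 𝓘(ℝ, E) 𝓘(ℝ, E) φ (γ t)).comp
        ((1 : ℝ →L[ℝ] ℝ).smulRight (X (γ t)))
      have h3 : HasFDerivWithinAt (fun t ↦ φ (γ t)) A (J ∩ W) t := h2.hasFDerivWithinAt
      have h4 := h3.hasDerivWithinAt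
      rw [hvφ _ (hC' t ht)]
      refine h4.congr_deriv ?_
      change mfderiv 𝓘(ℝ, E) 𝓘(ℝ, E) φ (γ t) ((1 : ℝ) • X (γ t)) = _
      rw [one_smul]
      rfl
  have hmaps : J ∩ W ⊆ (fun t ↦ φ (γ t)) ⁻¹' φ.target :=
    fun t ht ↦ φ.map_source (hCφ _ (hC' t ht))
  have hcomp := (contMDiffOn_extChartAt_symm (I := 𝓘(ℝ, E)) (n := ∞) (γ t₀)).comp
    hs.contMDiffOn hmaps
  have := (hcomp.congr fun t ht ↦ (φ.left_inv (hCφ _ (hC' t ht))).symm) t₀ ⟨ht₀, ht₀W⟩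
  exact (contMDiffWithinAt_inter (hW.mem_nhds ht₀W)).1 this

variable [RiemannianBundle (fun x : M ↦ TangentSpace 𝓘(ℝ, E) x)]
  [IsContMDiffRiemannianBundle 𝓘(ℝ, E) ∞ E (fun x : M ↦ TangentSpace 𝓘(ℝ, E) x)]
  [FiniteDimensional ℝ E] {k : ℕ}

/-- Integral curves of the fields of a frame with `D_{F_i} F_i = 0` are nonholonomic geodesics. -/
theorem isNonholonomicGeodesicOn_of_isMIntegralCurveOn (S : SmoothDistribution 𝓘(ℝ, E) M k)
    {F : Fin k → Π x : M, TangentSpace 𝓘(ℝ, E) x} {O : Set M} (hO : IsOpen O)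
    (hF : IsFrameOn S.fiber F O) {i : Fin k}
    (hD : ∀ x ∈ O, horizontalConnection S (F i) x (F i x) = 0)
    {γ : ℝ → M} {J : Set ℝ} (hJ : J.OrdConnected) (hJn : J.Nontrivial) (hγO : ∀ t ∈ J, γ t ∈ O)
    (hγ : IsMIntegralCurveOn γ (F i) J) : IsNonholonomicGeodesicOn S γ J := by
  have hJu := uniqueDiffOn_of_ordConnected hJ hJn
  have hvel : ∀ t ∈ J, velocityWithin 𝓘(ℝ, E) γ J t = F i (γ t) := by
    intro t ht
    rw [velocityWithin, (hγ t ht).mfderivWithin (hJu.uniqueMDiffOn t ht)]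
    exact one_smul ℝ (F i (γ t))
  refine ⟨contMDiffOn_of_isMIntegralCurveOn hO (hF.contMDiffOn i) hJu hγO hγ, fun t ht ↦ ?_,
    fun t ht ↦ ?_⟩
  · rw [hvel t ht]
    exact hF.mem (hγO t ht) i
  -- The horizontal derivative is computed in the frame `F` itself: the velocity has the constant
  -- coefficients of the `i`-th coordinate vector, so only `D_{F i} F i` remains.
  · refine ⟨O, hO, hγO t ht, F, hF, fun j _ ↦ Pi.single (M := fun _ ↦ ℝ) i 1 j, 0, ?_,
      fun j ↦ hasDerivWithinAt_const _ _ _, ?_⟩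
    · filter_upwards [self_mem_nhdsWithin] with s hs
      simp [hvel s hs, Pi.single_apply]
    · simp [hvel t ht, Pi.single_apply, hD _ (hγO t ht)]

end IntegralCurves

end SubRiemannian

open SubRiemannian in
theorem mainTheorem4 {E : Type*} [NormedAddCommGroup E] [NormedSpace ℝ E] [FiniteDimensional ℝ E]
    {M : Type*} [TopologicalSpace M] [ChartedSpace E M] [IsManifold 𝓘(ℝ, E) ∞ M]
    [RiemannianBundle (fun x : M ↦ TangentSpace 𝓘(ℝ, E) x)]
    [IsContMDiffRiemannianBundle 𝓘(ℝ, E) ∞ E (fun x : M ↦ TangentSpace 𝓘(ℝ, E) x)]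
    {k : ℕ} (S : SmoothDistribution 𝓘(ℝ, E) M k) (y : M) :
    ∃ O : Set M, IsOpen O ∧ y ∈ O ∧
      ∃ F : Fin k → Π x : M, TangentSpace 𝓘(ℝ, E) x,
        IsFrameOn S.fiber F O ∧
        (∀ i, ∀ x ∈ O, (inner ℝ (F i x) (F i x) : ℝ) = 1) ∧
        ∀ i, ∀ (γ : ℝ → M) (J : Set ℝ), J.OrdConnected → J.Nontrivial → (∀ t ∈ J, γ t ∈ O) →
          IsMIntegralCurveOn γ (F i) J → IsNonholonomicGeodesicOn S γ J := by
  obtain ⟨O, hO, hy, F, hF, hFO⟩ := exists_unit_geodesic_frame S y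
  exact ⟨O, hO, hy, F, hF, fun i x hx ↦ (hFO i x hx).1, fun i γ J hJ hJn hγO hγ ↦
    isNonholonomicGeodesicOn_of_isMIntegralCurveOn S hO hF (fun x hx ↦ (hFO i x hx).2) hJ hJn hγO
      hγ⟩
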